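/- **Setting.** Let $A,B$ be finite-dimensional quantum systems. $\mathrm D(A)$ is the set of superoperators $\mathcal E^+-\mathcal E^-$ with $\mathcal E^\pm$ completely positive and $\mathcal E^++\mathcal E^-$ trace-nonincreasing. $\mathrm{LOCC}(A,B)$ is the set of maps on $A\otimes B$ realized by protocols with finitely many rounds built from local operations (products of maps in $\mathrm D$, and local measurements with finitely many outcomes whose branches may carry signs $\pm1$ in post-processing; local ancillas are allowed) and two-way classical communication. For a superoperator $\mathcal E$ put $$\gamma_{\mathrm{LOCC}}(\mathcal E)=\min\Big\{\sum_{i=1}^N|a_i| : \mathcal E=\sum_{i=1}^N a_i\mathcal F_i,\ N\ge 1,\ a_i\in\mathbb R,\ \mathcal F_i\in\mathrm{LOCC}(A,B)\Big\},$$ for a unitary $U$ let $\gamma_{\mathrm{LOCC}}(U)$ be the value for the channel $\rho\mapsto U\rho U^\dagger$, for a state $\rho_{AB}$ let $\gamma_{\mathrm{LOCC}}(\rho)=\min\{\gamma_{\mathrm{LOCC}}(\mathcal E):\mathcal E(|0\rangle\langle 0|_{AB})=\rho\}$, where $|0\rangle_{AB}$ is the state in which all qubits are in $|0\rangle$, and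 put $\gamma^{(k)}_{\mathrm{LOCC}}(U)=\gamma_{\mathrm{LOCC}}(U^{\otimes k})^{1/k}$ with respect to $A^{\otimes k}:B^{\otimes k}$. The Choi state of $U_{AB}$ is $|\Phi_U\rangle_{AA'BB'}=(U_{AB}\otimes 1_{A'B'})(|\Psi\rangle_{AA'}\otimes|\Psi\rangle_{BB'})$, with $A',B'$ copies of $A,B$ and $|\Psi\rangle$ the standard maximally entangled state $d^{-1/2}\sum_i|i\rangle|i\rangle$. Write $\Phi_U=|\Phi_U\rangle\langle\Phi_U|$. **Theorem.** Let $A$ consist of $a$ and $B$ of $b$ qubits, let $U_{AB}$ be a Clifford unitary (a unitary that maps the Pauli group on $a+b$ qubits onto itself under conjugation), and let $\{\alpha_i\}$ be the Schmidt coefficients of $|\Phi_U\rangle$ as a bipartite state over $A\otimes A'$ and $B\otimes B'$. 1. $\gamma_{\mathrm{LOCC}}(U)=\gamma_{\mathrm{LOCC}}(\Phi_U)=2\big(\sum_i\alpha_i\big)^2-1.$ 2. For every integer $k\ge1$, $$\gamma^{(k)}_{\mathrm{LOCC}}(U)=\gamma_{\mathrm{LOCC}}(\Phi_U^{\otimes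 k})^{1/k}=\Big(2\big(\textstyle\sum_i\alpha_i\big)^{2k}-1\Big)^{1/k}.$$ All minima that define the quantities in 1 and 2 are attained. 3. (Gate teleportation.) There is a fixed LOCC map $T$ that implements $U$ exactly while consuming one copy of $\Phi_U$. For every $k\ge 1$, with a memory that stores $k$ Choi states ($2k(a+b)$ qubits), the effective factor in 2 is achieved: there are finitely many real $a_i$ with $\sum_i|a_i|=2(\sum_j\alpha_j)^{2k}-1$ and LOCC maps $\mathcal F_i$ on the memory with $\Phi_U^{\otimes k}=\sum_i a_i\mathcal F_i(|0\rangle\langle0|)$ such that, for every circuit on $A\otimes B$ and any number of further qubits of either party that consists of $k$ uses of $U$ interleaved with LOCC maps, replacing each use of $U$ by $T$ acting on the next memory cell, with the memory initially in $\mathcal F_i(|0\rangle\langle0|)$, gives an LOCC map $\mathcal S_i$, and the circuit equals $\sum_i a_i\mathcal S_i$. 4. If $U$ is entangling, i.e. not a product of local unitaries, then $(\sum_i\alpha_i)^2>1$ and $\gamma^{(k)}_{\mathrm{LOCC}}(U)<\gamma_{\mathrm{LOCC}}(U)$ for all $k>1$. 5. The total sampling overhead of $n$ instances of $U$ is $\gamma^{(n)}_{\mathrm{LOCC}}(U)^{2n}=O\big((\sum_i\alpha_i)^{4n}\big)$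 as $n\to\infty$. In particular, the CNOT gate between one qubit of $A$ and one qubit of $B$ is an entangling Clifford gate with $\gamma_{\mathrm{LOCC}}(\mathrm{CNOT})=3$ and $\gamma^{(k)}_{\mathrm{LOCC}}(\mathrm{CNOT})=(2^{k+1}-1)^{1/k}$ for $k\ge1$; statement 3 holds for it with a Bell pair in place of the Choi state, so with a memory of $2k$ qubits and one-norm $2^{k+1}-1$; and the overhead for $n$ CNOT gates drops from $\gamma_{\mathrm{LOCC}}(\mathrm{CNOT})^{2n}=9^n$ to $\gamma^{(n)}_{\mathrm{LOCC}}(\mathrm{CNOT})^{2n}=O(4^n)$. -/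

import Mathlib

open scoped ENNReal Kronecker ComplexOrder

/-! ## Superoperators

A finite-dimensional system is given by a finite type `m` labelling an orthonormal basis; operators
on it are matrices `Matrix m m ℂ`, and a bipartite system `A ⊗ B` is labelled by `m × n`. -/

/-- Linear maps from operators on the system `m` to operators on the system `m'`. -/
abbrev Superop (m m' : Type) : Type := Matrix m m ℂ →ₗ[ℂ] Matrix m' m' ℂ

/-- `Φ ⊗ id` on `m × r`: `Φ` is applied to every `r`-block. -/
def ampRight {m m' : Type} (r : Type) (Φ : Superop m m') : Superop (m × r) (m' × r) where
  toFun X := Matrix.of fun x y => Φ (Matrix.of fun i j => X (i, x.2) (j, y.2)) x.1 y.1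
  map_add' X Y := by
    ext x y
    exact congrFun (congrFun (map_add Φ (Matrix.of fun i j => X (i, x.2) (j, y.2))
      (Matrix.of fun i j => Y (i, x.2) (j, y.2))) x.1) y.1
  map_smul' c X := by
    ext x y
    exact congrFun (congrFun (map_smul Φ c (Matrix.of fun i j => X (i, x.2) (j, y.2))) x.1) y.1

/-- `id ⊗ Φ` on `r × m`. -/
def ampLeft {m m' : Type} (r : Type) (Φ : Superop m m') : Superop (r × m) (r × m') where
  toFun X := Matrix.of fun x y => Φ (Matrix.of fun i j => X (x.1, i) (y.1, j)) x.2 y.2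
  map_add' X Y := by
    ext x y
    exact congrFun (congrFun (map_add Φ (Matrix.of fun i j => X (x.1, i) (y.1, j))
      (Matrix.of fun i j => Y (x.1, i) (y.1, j))) x.2) y.2
  map_smul' c X := by
    ext x y
    exact congrFun (congrFun (map_smul Φ c (Matrix.of fun i j => X (x.1, i) (y.1, j))) x.2) y.2

/-- The product `Φ ⊗ Ψ` of two superoperators. -/
def tensorOp {m m' n n' : Type} (Φ : Superop m m') (Ψ : Superop n n') :
    Superop (m × n) (m' × n') :=
  (ampRight n' Φ) ∘ₗ (ampLeft m Ψ)

/-- Relabelling of the basis of a system. -/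
def relabel {m m' : Type} (e : m ≃ m') : Superop m m' :=
  (Matrix.reindexLinearEquiv ℂ ℂ e e).toLinearMap

/-- Complete positivity: all ampliations `Φ ⊗ id` preserve positive semidefiniteness. -/
def IsCP {m m' : Type} (Φ : Superop m m') : Prop :=
  ∀ (r : ℕ) (X : Matrix (m × Fin r) (m × Fin r) ℂ),
    X.PosSemidef → (ampRight (Fin r) Φ X).PosSemidef

/-- The superoperator does not increase the trace of positive semidefinite operators. -/
def TraceNonincreasing {m m' : Type} [Fintype m] [Fintype m'] (Φ : Superop m m') : Prop :=
  ∀ X : Matrix m m ℂ, X.PosSemidef → (Φ X).trace.re ≤ X.trace.re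

/-- The class `D`: differences `Φ⁺ - Φ⁻` of completely positive maps such that `Φ⁺ + Φ⁻` is
trace-nonincreasing (hence so are `Φ⁺` and `Φ⁻`). -/
def IsDOp {m m' : Type} [Fintype m] [Fintype m'] (Φ : Superop m m') : Prop :=
  ∃ P N : Superop m m', IsCP P ∧ IsCP N ∧ TraceNonincreasing (P + N) ∧ Φ = P - N

/-- A measurement with finitely many outcomes `j` whose branches are weighted by signs in
post-processing: branch `j` implements `P j - N j`, where all `P j`, `N j` are completely positive
and their total sum is trace-nonincreasing. With one outcome this is an element of the class `D`. -/
def IsSignedInstrument {m m' : Type} [Fintype m] [Fintype m'] {r : ℕ}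
    (E : Fin r → Superop m m') : Prop :=
  ∃ P N : Fin r → Superop m m', (∀ j, IsCP (P j)) ∧ (∀ j, IsCP (N j)) ∧
    TraceNonincreasing (∑ j, (P j + N j)) ∧ ∀ j, E j = P j - N j

/-- Maps realized by protocols with local operations and finitely many rounds of two-way classical
communication. A protocol either ends with a product of local operations, or one party applies a
(signed) instrument, announces the outcome `j`, and the parties go on with a protocol `R j` that may
depend on `j`. Local systems may change during the protocol, so local ancillas are allowed. -/
inductive IsLOCC {m' n' : Type} [Fintype m'] [Fintype n'] :
    ∀ {m n : Type} [Fintype m] [Fintype n], Superop (m × n) (m' × n') → Prop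
  | local_op {m n : Type} [Fintype m] [Fintype n] (Φ : Superop m m') (Ψ : Superop n n')
      (hΦ : IsDOp Φ) (hΨ : IsDOp Ψ) : IsLOCC (tensorOp Φ Ψ)
  | alice {m n m₁ : Type} [Fintype m] [Fintype n] [Fintype m₁] (r : ℕ)
      (E : Fin r → Superop m m₁) (R : Fin r → Superop (m₁ × n) (m' × n'))
      (hE : IsSignedInstrument E) (hR : ∀ j, IsLOCC (R j)) :
      IsLOCC (∑ j, R j ∘ₗ ampRight n (E j))
  | bob {m n n₁ : Type} [Fintype m] [Fintype n] [Fintype n₁] (r : ℕ)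
      (E : Fin r → Superop n n₁) (R : Fin r → Superop (m × n₁) (m' × n'))
      (hE : IsSignedInstrument E) (hR : ∀ j, IsLOCC (R j)) :
      IsLOCC (∑ j, R j ∘ₗ ampLeft m (E j))

/-! ## The γ-factor -/

/-- The one-norms `∑ |a i|` of all quasiprobability decompositions `Φ = ∑ a i • F i`, `F i` LOCC. -/
def qpdCosts {m n m' n' : Type} [Fintype m] [Fintype n] [Fintype m'] [Fintype n']
    (Φ : Superop (m × n) (m' × n')) : Set ℝ≥0∞ :=
  {κ | ∃ N : ℕ, 1 ≤ N ∧ ∃ (a : Fin N → ℝ) (F : Fin N → Superop (m × n) (m' × n')),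
    (∀ i, IsLOCC (F i)) ∧ Φ = ∑ i, (a i : ℂ) • F i ∧ κ = ENNReal.ofReal (∑ i, |a i|)}

/-- The γ-factor of a superoperator over LOCC (`∞` if there is no decomposition). -/
noncomputable def gammaLOCC {m n m' n' : Type} [Fintype m] [Fintype n] [Fintype m'] [Fintype n']
    (Φ : Superop (m × n) (m' × n')) : ℝ≥0∞ :=
  sInf (qpdCosts Φ)

/-- The projector onto the product basis state `|0⟩ ⊗ |0⟩`. -/
def zeroState (m n : Type) [DecidableEq m] [DecidableEq n] [Zero m] [Zero n] :
    Matrix (m × n) (m × n) ℂ :=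
  Matrix.single (0, 0) (0, 0) 1

/-- The γ-factors of all superoperators that map `|0⟩⟨0|` to `ρ`. -/
def statePrepCosts {m n : Type} [Fintype m] [Fintype n] [DecidableEq m] [DecidableEq n]
    [Zero m] [Zero n] (ρ : Matrix (m × n) (m × n) ℂ) : Set ℝ≥0∞ :=
  {κ | ∃ Φ : Superop (m × n) (m × n), Φ (zeroState m n) = ρ ∧ κ = gammaLOCC Φ}

/-- The γ-factor of a bipartite state over LOCC. -/
noncomputable def gammaLOCCState {m n : Type} [Fintype m] [Fintype n] [DecidableEq m]
    [DecidableEq n] [Zero m] [Zero n] (ρ : Matrix (m × n) (m × n) ℂ) : ℝ≥0∞ :=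
  sInf (statePrepCosts ρ)

/-- The channel `ρ ↦ U ρ U†`. -/
def unitaryChannel {m : Type} [Fintype m] (U : Matrix m m ℂ) : Superop m m where
  toFun ρ := U * ρ * U.conjTranspose
  map_add' ρ σ := by rw [Matrix.mul_add, Matrix.add_mul]
  map_smul' c ρ := by simp

/-- The `k`-fold tensor power of an operator on `A ⊗ B`, as an operator on `A^{⊗k} ⊗ B^{⊗k}`. -/
def tensorPow {m n : Type} (k : ℕ) (M : Matrix (m × n) (m × n) ℂ) :
    Matrix ((Fin k → m) × (Fin k → n)) ((Fin k → m) × (Fin k → n)) ℂ :=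
  Matrix.of fun x y => ∏ i, M (x.1 i, x.2 i) (y.1 i, y.2 i)

/-- The effective γ-factor per gate, `γ(U^{⊗k})^{1/k}`. -/
noncomputable def effGammaLOCC {m n : Type} [Fintype m] [Fintype n] (k : ℕ)
    (U : Matrix (m × n) (m × n) ℂ) : ℝ≥0∞ :=
  gammaLOCC (unitaryChannel (tensorPow k U)) ^ ((1 : ℝ) / k)

/-! ## States -/

/-- The projector `|ψ⟩⟨ψ|`. -/
def proj {m : Type} (ψ : m → ℂ) : Matrix m m ℂ := Matrix.vecMulVec ψ (star ψ)

/-- The amplitudes of the maximally entangled state `|Ψ⟩ = d^{-1/2} ∑ᵢ |i⟩|i⟩` of two copies of a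
`d`-dimensional system. -/
noncomputable def maxEnt (m : Type) [Fintype m] [DecidableEq m] : m × m → ℂ :=
  fun x => if x.1 = x.2 then ((1 / Real.sqrt (Fintype.card m) : ℝ) : ℂ) else 0

/-- The Choi state `(U_{AB} ⊗ 1_{A'B'}) |Ψ⟩_{AA'} |Ψ⟩_{BB'}`, with basis labels ordered as
`((A, A'), (B, B'))`. -/
noncomputable def choi {m n : Type} [Fintype m] [Fintype n] [DecidableEq m] [DecidableEq n]
    (U : Matrix (m × n) (m × n) ℂ) : (m × m) × (n × n) → ℂ :=
  fun x => ∑ y : m × n, U (x.1.1, x.2.1) y * (maxEnt m (y.1, x.1.2) * maxEnt n (y.2, x.2.2))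

/-- `α` are Schmidt coefficients of `ψ`: `ψ = ∑ₛ αₛ |eₛ⟩ ⊗ |fₛ⟩` with `αₛ ≥ 0` and orthonormal
families `e` and `f`. -/
def HasSchmidtCoefficients {m n : Type} [Fintype m] [Fintype n] (ψ : m × n → ℂ) {r : ℕ}
    (α : Fin r → ℝ) : Prop :=
  (∀ s, 0 ≤ α s) ∧ ∃ (e : Fin r → EuclideanSpace ℂ m) (f : Fin r → EuclideanSpace ℂ n),
    Orthonormal ℂ e ∧ Orthonormal ℂ f ∧ ∀ i j, ψ (i, j) = ∑ s, (α s : ℂ) * (e s i * f s j)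

/-! ## Qubits and Clifford unitaries -/

/-- Computational basis labels of a register of `a` qubits. -/
abbrev Qubits (a : ℕ) : Type := Fin a → Fin 2

/-- The single-qubit matrices `1, X, Y, Z`. -/
noncomputable def pauliMatrix : Fin 4 → Matrix (Fin 2) (Fin 2) ℂ :=
  ![1, !![0, 1; 1, 0], !![0, -Complex.I; Complex.I, 0], !![1, 0; 0, -1]]

/-- The tensor product `σ_{s 0} ⊗ ⋯ ⊗ σ_{s (a-1)}`. -/
noncomputable def pauliString {a : ℕ} (s : Fin a → Fin 4) : Matrix (Qubits a) (Qubits a) ℂ :=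
  Matrix.of fun x y => ∏ i, pauliMatrix (s i) (x i) (y i)

/-- The Pauli group on `a + b` qubits, of which `a` belong to `A` and `b` belong to `B`. -/
def pauliGroup (a b : ℕ) : Set (Matrix (Qubits a × Qubits b) (Qubits a × Qubits b) ℂ) :=
  {P | ∃ (c : Fin 4) (s : Fin a → Fin 4) (t : Fin b → Fin 4),
    P = Complex.I ^ (c : ℕ) • (pauliString s ⊗ₖ pauliString t)}

/-- Clifford unitaries: unitaries `U` with `U P U† = P` for the Pauli group `P`. -/
def IsClifford {a b : ℕ} (U : Matrix (Qubits a × Qubits b) (Qubits a × Qubits b) ℂ) : Prop :=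
  U ∈ Matrix.unitaryGroup (Qubits a × Qubits b) ℂ ∧
    (fun P => U * P * U.conjTranspose) '' pauliGroup a b = pauliGroup a b

/-- `U` is entangling (nonlocal): it is not a product of local unitaries. -/
def IsEntangling {m n : Type} [Fintype m] [Fintype n] [DecidableEq m] [DecidableEq n]
    (U : Matrix (m × n) (m × n) ℂ) : Prop :=
  ¬ ∃ V ∈ Matrix.unitaryGroup m ℂ, ∃ W ∈ Matrix.unitaryGroup n ℂ, U = V ⊗ₖ W

/-- The CNOT gate between one qubit of `A` (the control) and one qubit of `B` (the target). -/
def cnot : Matrix (Qubits 1 × Qubits 1) (Qubits 1 × Qubits 1) ℂ :=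
  Matrix.of fun x y => if x.1 = y.1 ∧ x.2 = y.2 + y.1 then 1 else 0

/-! ## Circuits with `k` uses of a gate, and their simulation by gate teleportation -/

/-- `Φ ⊗ id` for a bipartite `Φ`, where `A` is enlarged by `r` and `B` is enlarged by `s`. -/
def extend {m n m' n' : Type} (r s : Type) (Φ : Superop (m × n) (m' × n')) :
    Superop ((m × r) × (n × s)) ((m' × r) × (n' × s)) :=
  relabel (Equiv.prodProdProdComm m' n' r s) ∘ₗ ampRight (r × s) Φ ∘ₗ
    relabel (Equiv.prodProdProdComm m r n s)

/-- `ρ ↦ ρ ⊗ τ`, with `A` enlarged by the `A`-part of `τ` and `B` by the `B`-part of `τ`. -/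
def attach {p q : Type} (m n : Type) (τ : Matrix (p × q) (p × q) ℂ) :
    Superop (m × n) ((m × p) × (n × q)) where
  toFun ρ := Matrix.of fun x y =>
    ρ (x.1.1, x.2.1) (y.1.1, y.2.1) * τ (x.1.2, x.2.2) (y.1.2, y.2.2)
  map_add' ρ σ := by ext x y; simp [add_mul]
  map_smul' c ρ := by ext x y; simp [mul_assoc]

/-- The circuit `G k ∘ U ∘ G (k-1) ∘ ⋯ ∘ U ∘ G 0` with `k` uses of the gate `U` on the subsystem
`m × n` of the full system `(m × c) × (n × d)`. -/
def gateCircuit {m n c d : Type} [Fintype m] [Fintype n] (U : Matrix (m × n) (m × n) ℂ) :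
    ∀ (_ : ℕ) (_ : ℕ → Superop ((m × c) × (n × d)) ((m × c) × (n × d))),
      Superop ((m × c) × (n × d)) ((m × c) × (n × d))
  | 0, G => G 0
  | k + 1, G => gateCircuit U k (fun i => G (i + 1)) ∘ₗ extend c d (unitaryChannel U) ∘ₗ G 0

/-- Splits off the first of `k + 1` memory cells and puts it next to the subsystem `m`. -/
def takeCell (m c p : Type) (k : ℕ) :
    (m × c) × (Fin (k + 1) → p) ≃ (m × p) × (c × (Fin k → p)) :=
  (Equiv.prodCongr (Equiv.refl (m × c)) (Fin.consEquiv fun _ : Fin (k + 1) => p).symm).trans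
    (Equiv.prodProdProdComm m c p (Fin k → p))

/-- One use of the gadget `T`, which acts on the subsystem `m × n` and consumes the first of `k + 1`
cells of the local memories. -/
def consumeCell {m n c d p q : Type} (T : Superop ((m × p) × (n × q)) (m × n)) (k : ℕ) :
    Superop (((m × c) × (Fin (k + 1) → p)) × ((n × d) × (Fin (k + 1) → q)))
      (((m × c) × (Fin k → p)) × ((n × d) × (Fin k → q))) :=
  relabel (Equiv.prodCongr (Equiv.prodAssoc m c (Fin k → p)).symm
      (Equiv.prodAssoc n d (Fin k → q)).symm) ∘ₗ
    extend (c × (Fin k → p)) (d × (Fin k → q)) T ∘ₗ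
      relabel (Equiv.prodCongr (takeCell m c p k) (takeCell n d q k))

/-- The circuit with `k` gate uses in which the gates are replaced by the gadget `T`, each use
consuming one of the `k` cells of the memory. -/
def gadgetCircuit {m n c d p q : Type} (T : Superop ((m × p) × (n × q)) (m × n)) :
    ∀ (k : ℕ) (_ : ℕ → Superop ((m × c) × (n × d)) ((m × c) × (n × d))),
      Superop (((m × c) × (Fin k → p)) × ((n × d) × (Fin k → q))) ((m × c) × (n × d))
  | 0, G => G 0 ∘ₗ relabel (Equiv.prodCongr (Equiv.prodUnique (m × c) (Fin 0 → p))
      (Equiv.prodUnique (n × d) (Fin 0 → q)))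
  | k + 1, G => gadgetCircuit T k (fun i => G (i + 1)) ∘ₗ consumeCell T k ∘ₗ
      extend (Fin (k + 1) → p) (Fin (k + 1) → q) (G 0)

/-- Gate teleportation of `U` with resource state `τ` achieves one-norm `κ k` for `k` gate uses.
There is an LOCC gadget `T` that consumes `τ` and implements `U` exactly. For every `k ≥ 1`
the memory state `τ^{⊗k}` has a quasiprobability decomposition `∑ a i • F i (|0⟩⟨0|)` with one-norm
`κ k`, and for all circuits with `k` uses of `U` interleaved with arbitrary LOCC maps `G j` on
arbitrarily many further qubits, replacing the gates by `T` and running the gadget circuit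
on the memory states `F i (|0⟩⟨0|)` gives LOCC maps which simulate the circuit with the same
coefficients `a i`. -/
def TeleportationAchieves {m n p q : Type} [Fintype m] [Fintype n] [Fintype p] [Fintype q]
    [DecidableEq p] [DecidableEq q] [Zero p] [Zero q]
    (U : Matrix (m × n) (m × n) ℂ) (τ : Matrix (p × q) (p × q) ℂ) (κ : ℕ → ℝ) : Prop :=
  ∃ T : Superop ((m × p) × (n × q)) (m × n), IsLOCC T ∧
    (∀ ρ, T (attach m n τ ρ) = unitaryChannel U ρ) ∧
    ∀ k : ℕ, 1 ≤ k →
      ∃ (N : ℕ) (a : Fin N → ℝ)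
        (F : Fin N → Superop ((Fin k → p) × (Fin k → q)) ((Fin k → p) × (Fin k → q))),
        (∀ i, IsLOCC (F i)) ∧ ∑ i, |a i| = κ k ∧
        tensorPow k τ = ∑ i, (a i : ℂ) • F i (zeroState (Fin k → p) (Fin k → q)) ∧
        ∀ (c d : ℕ) (G : ℕ → Superop ((m × Qubits c) × (n × Qubits d))
            ((m × Qubits c) × (n × Qubits d))), (∀ j, IsLOCC (G j)) →
          (∀ i, IsLOCC (gadgetCircuit T k G ∘ₗ attach (m × Qubits c) (n × Qubits d)
            (F i (zeroState (Fin k → p) (Fin k → q))))) ∧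
          gateCircuit U k G = ∑ i, (a i : ℂ) • (gadgetCircuit T k G ∘ₗ
            attach (m × Qubits c) (n × Qubits d)
              (F i (zeroState (Fin k → p) (Fin k → q))))

/-! ## Kraus maps and complete positivity -/

/-! Everything reduces to one number, the γ-factor of a bipartite pure state with Schmidt
coefficients `α`, together with two observations that tie a Clifford gate to its Choi state.

Lower bound. Let `φ = ∑ e s ⊗ f s` be the sum of the Schmidt vectors with all weights equal to one,
and consider `Z ↦ 2⟨φ|Z|φ⟩ - tr Z`. By Cauchy–Schwarz and Bessel a product vector has squared
overlap with `φ` at most its own squared norm, so the functional has absolute value at most one on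
product states (`norm_witness_proj_kronecker_le`). This bound survives every LOCC map, signs
included, because each round maps product inputs to products and the class D bounds the trace of the
sum of the positive and negative parts (`IsLOCC.norm_apply_kronecker_le`). On the target state the
overlap with `φ` is `∑ α`, so the functional equals `2 (∑ α)² - 1`, and every quasiprobability
decomposition must pay at least that.

Upper bound. Average product vectors with amplitudes `√α` over opposite random phases for the two
parties. Besides the pure state, only the product terms `α s α t · e s ⊗ f t` with `s ≠ t` survive,
and these can be subtracted at cost `(∑ α)² - 1` (`sum_proj_phaseVec`,
`IsSchmidt.exists_product_decomposition`). Preparing a product state is a local operation, so the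
bound is met and the minimum is attained.

From states to gates. A unitary creates its Choi state from a product across the cut, so its
γ-factor is at least that of the Choi state. Conversely, teleporting the input through the Choi
state yields `U` preceded by a product Pauli operator; conjugation by a Clifford gate turns this
into a local correction after `U`, so one Choi state and LOCC suffice
(`IsTeleportable.exists_gadget`). By linearity a decomposition of the resource becomes a
decomposition of the gate, or of a whole circuit with `k` gates (`gadgetCircuit_comp_attach`).

Powers. Schmidt coefficients multiply under tensor powers, so `∑ α` becomes `(∑ α)^k`, while the
terms with factor 2 and -1 do not multiply. The strict advantage is the inequality `2 x^k - 1 < (2 x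
- 1)^k` for `x > 1`. For CNOT the Schmidt coefficients are those of a Bell pair, and a cheaper
gadget consumes a Bell pair directly. -/

/-- The superoperator `X ↦ K X K†`. -/
def kraus {m m' : Type} [Fintype m] (K : Matrix m' m ℂ) : Superop m m' where
  toFun X := K * X * K.conjTranspose
  map_add' X Y := by rw [Matrix.mul_add, Matrix.add_mul]
  map_smul' c X := by simp

theorem kraus_apply {m m' : Type} [Fintype m] (K : Matrix m' m ℂ) (X : Matrix m m ℂ) :
    kraus K X = K * X * K.conjTranspose := rfl

theorem unitaryChannel_eq_kraus {m : Type} [Fintype m] (U : Matrix m m ℂ) :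
    unitaryChannel U = kraus U := rfl

theorem kraus_comp {m m' m'' : Type} [Fintype m] [Fintype m'] (K : Matrix m' m ℂ)
    (L : Matrix m'' m' ℂ) : kraus L ∘ₗ kraus K = kraus (L * K) := by
  ext1 X
  simp [kraus_apply, Matrix.mul_assoc]

theorem kraus_smul {m m' : Type} [Fintype m] (c : ℂ) (K : Matrix m' m ℂ) :
    kraus (c • K) = (c * star c) • kraus K := by
  ext1 X
  simp [kraus_apply, smul_smul, mul_comm]

theorem ampRight_apply {m m' : Type} (r : Type) (Φ : Superop m m')
    (X : Matrix (m × r) (m × r) ℂ) (x y : m' × r) :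
    ampRight r Φ X x y = Φ (Matrix.of fun i j => X (i, x.2) (j, y.2)) x.1 y.1 := rfl

theorem ampLeft_apply {m m' : Type} (r : Type) (Φ : Superop m m')
    (X : Matrix (r × m) (r × m) ℂ) (x y : r × m') :
    ampLeft r Φ X x y = Φ (Matrix.of fun i j => X (x.1, i) (y.1, j)) x.2 y.2 := rfl

theorem ampRight_kraus {m m' : Type} [Fintype m] (r : Type) [Fintype r] [DecidableEq r]
    (K : Matrix m' m ℂ) : ampRight r (kraus K) = kraus (K ⊗ₖ (1 : Matrix r r ℂ)) := by
  ext1 X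
  ext x y
  simp [ampRight_apply, kraus_apply, Matrix.mul_apply, Fintype.sum_prod_type, Matrix.one_apply,
    apply_ite (starRingEnd ℂ)]

theorem ampLeft_kraus {m m' : Type} [Fintype m] (r : Type) [Fintype r] [DecidableEq r]
    (K : Matrix m' m ℂ) : ampLeft r (kraus K) = kraus ((1 : Matrix r r ℂ) ⊗ₖ K) := by
  ext1 X
  ext x y
  simp [ampLeft_apply, kraus_apply, Matrix.mul_apply, Fintype.sum_prod_type, Matrix.one_apply,
    apply_ite (starRingEnd ℂ), Finset.sum_mul]

theorem tensorOp_kraus {m m' n n' : Type} [Fintype m] [Fintype n] [Fintype n']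
    (K : Matrix m' m ℂ) (L : Matrix n' n ℂ) :
    tensorOp (kraus K) (kraus L) = kraus (K ⊗ₖ L) := by
  classical
  rw [tensorOp, ampRight_kraus, ampLeft_kraus, kraus_comp, ← Matrix.mul_kronecker_mul]
  simp

theorem ampRight_sum {m m' ι : Type} [Fintype ι] (r : Type) (Φ : ι → Superop m m') :
    ampRight r (∑ i, Φ i) = ∑ i, ampRight r (Φ i) := by
  ext1 X
  ext x y
  simp [ampRight_apply, Matrix.sum_apply]

theorem ampRight_sub {m m' : Type} (r : Type) (Φ Ψ : Superop m m') :
    ampRight r (Φ - Ψ) = ampRight r Φ - ampRight r Ψ := rfl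

/-- Complete positivity is tested only with ancillas `Fin r`; relabelling the basis carries it to
every finite ancilla. -/
theorem IsCP.ampRight_posSemidef {m m' r : Type} [Finite r] {Φ : Superop m m'} (h : IsCP Φ)
    {X : Matrix (m × r) (m × r) ℂ} (hX : X.PosSemidef) : (ampRight r Φ X).PosSemidef := by
  obtain ⟨k, ⟨e⟩⟩ := Finite.exists_equiv_fin r
  have h1 := h k _ (hX.submatrix (Prod.map id e.symm))
  have h2 := h1.submatrix (Prod.map id e)
  convert h2 using 1
  ext x y
  simp [ampRight_apply, Matrix.submatrix]

theorem IsCP.posSemidef {m m' : Type} {Φ : Superop m m'} (h : IsCP Φ)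
    {X : Matrix m m ℂ} (hX : X.PosSemidef) : (Φ X).PosSemidef := by
  have h1 := h.ampRight_posSemidef (r := Unit) (hX.submatrix Prod.fst)
  exact h1.submatrix fun i => (i, ())

theorem IsCP.ampRight {m m' : Type} (r : Type) [Finite r] {Φ : Superop m m'} (h : IsCP Φ) :
    IsCP (ampRight r Φ) := by
  intro k X hX
  have h1 := h.ampRight_posSemidef (r := r × Fin k)
    (hX.submatrix fun p : m × (r × Fin k) => ((p.1, p.2.1), p.2.2))
  exact h1.submatrix fun p : (m' × r) × Fin k => (p.1.1, (p.1.2, p.2))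

theorem isCP_kraus {m m' : Type} [Fintype m] [Fintype m'] (K : Matrix m' m ℂ) :
    IsCP (kraus K) := by
  intro r X hX
  rw [ampRight_kraus, kraus_apply]
  exact hX.mul_mul_conjTranspose_same _

theorem isCP_zero {m m' : Type} : IsCP (0 : Superop m m') := by
  intro r X _
  exact Matrix.PosSemidef.zero

theorem IsCP.sum {m m' ι : Type} [Fintype ι] {Φ : ι → Superop m m'} (h : ∀ i, IsCP (Φ i)) :
    IsCP (∑ i, Φ i) := by
  intro r X hX
  rw [ampRight_sum, LinearMap.sum_apply]
  exact Matrix.posSemidef_sum _ fun i _ => h i r X hX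

theorem trace_ampRight {m m' r : Type} [Fintype m] [Fintype m'] [Fintype r] (Φ : Superop m m')
    (X : Matrix (m × r) (m × r) ℂ) :
    (ampRight r Φ X).trace = ∑ k, (Φ (Matrix.of fun i j => X (i, k) (j, k))).trace := by
  simp only [Matrix.trace, Matrix.diag, Fintype.sum_prod_type, ampRight_apply]
  exact Finset.sum_comm

/-- The trace splits over the diagonal blocks of the ancilla, and each block is a principal
submatrix, hence positive semidefinite. No positivity of `Φ` itself enters. -/
theorem TraceNonincreasing.ampRight {m m' : Type} (r : Type) [Fintype m] [Fintype m'] [Fintype r]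
    {Φ : Superop m m'} (h : TraceNonincreasing Φ) : TraceNonincreasing (ampRight r Φ) := by
  intro X hX
  have : X.trace = ∑ k, (Matrix.of fun i j => X (i, k) (j, k)).trace := by
    simp only [Matrix.trace, Matrix.diag, Fintype.sum_prod_type, Matrix.of_apply]
    exact Finset.sum_comm
  rw [trace_ampRight, this, Complex.re_sum, Complex.re_sum]
  exact Finset.sum_le_sum fun k _ => h _ (hX.submatrix fun i => (i, k))

theorem isDOp_of_isCP {m m' : Type} [Fintype m] [Fintype m'] {Φ : Superop m m'} (h : IsCP Φ)
    (h' : TraceNonincreasing Φ) : IsDOp Φ :=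
  ⟨Φ, 0, h, isCP_zero, by simpa using h', by simp⟩

theorem IsDOp.ampRight {m m' : Type} (r : Type) [Fintype m] [Fintype m'] [Fintype r]
    {Φ : Superop m m'} (h : IsDOp Φ) : IsDOp (ampRight r Φ) := by
  obtain ⟨P, N, hP, hN, ht, rfl⟩ := h
  exact ⟨_, _, hP.ampRight r, hN.ampRight r, ht.ampRight r, rfl⟩

theorem IsSignedInstrument.ampRight {m m' : Type} (s : Type) [Fintype m] [Fintype m'] [Fintype s]
    {r : ℕ} {E : Fin r → Superop m m'} (h : IsSignedInstrument E) :
    IsSignedInstrument fun j => ampRight s (E j) := by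
  obtain ⟨P, N, hP, hN, ht, hE⟩ := h
  refine ⟨_, _, fun j => (hP j).ampRight s, fun j => (hN j).ampRight s, ?_, fun j => ?_⟩
  · have := ht.ampRight s
    rwa [ampRight_sum] at this
  · simp only [hE, ampRight_sub]

theorem IsDOp.isSignedInstrument {m m' : Type} [Fintype m] [Fintype m'] {Φ : Superop m m'}
    (h : IsDOp Φ) : IsSignedInstrument fun _ : Fin 1 => Φ := by
  obtain ⟨P, N, hP, hN, ht, rfl⟩ := h
  exact ⟨fun _ => P, fun _ => N, fun _ => hP, fun _ => hN, by simpa using ht, fun _ => rfl⟩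

theorem trace_kraus {m m' : Type} [Fintype m] [Fintype m'] (K : Matrix m' m ℂ)
    (X : Matrix m m ℂ) : (kraus K X).trace = (K.conjTranspose * K * X).trace := by
  rw [kraus_apply, Matrix.trace_mul_comm, ← Matrix.mul_assoc]

theorem traceNonincreasing_sum_kraus {m m' ι : Type} [Fintype m] [Fintype m'] [Fintype ι]
    [DecidableEq m] {K : ι → Matrix m' m ℂ} (h : ∑ i, (K i).conjTranspose * K i = 1) :
    TraceNonincreasing (∑ i, kraus (K i)) := by
  intro X _
  rw [LinearMap.sum_apply, Matrix.trace_sum]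
  simp_rw [trace_kraus]
  rw [← Matrix.trace_sum, ← Matrix.sum_mul, h, one_mul]

theorem isSignedInstrument_kraus {m m' : Type} [Fintype m] [Fintype m'] [DecidableEq m] {r : ℕ}
    {K : Fin r → Matrix m' m ℂ} (h : ∑ i, (K i).conjTranspose * K i = 1) :
    IsSignedInstrument fun i => kraus (K i) :=
  ⟨_, fun _ => 0, fun i => isCP_kraus (K i), fun _ => isCP_zero,
    by simpa using traceNonincreasing_sum_kraus h, fun _ => by simp⟩

theorem isDOp_sum_kraus {m m' ι : Type} [Fintype m] [Fintype m'] [Fintype ι] [DecidableEq m]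
    {K : ι → Matrix m' m ℂ} (h : ∑ i, (K i).conjTranspose * K i = 1) :
    IsDOp (∑ i, kraus (K i)) :=
  isDOp_of_isCP (IsCP.sum fun i => isCP_kraus (K i)) (traceNonincreasing_sum_kraus h)

theorem isDOp_kraus {m m' : Type} [Fintype m] [Fintype m'] [DecidableEq m]
    {K : Matrix m' m ℂ} (h : K.conjTranspose * K = 1) : IsDOp (kraus K) := by
  simpa using isDOp_sum_kraus (K := fun _ : Unit => K) (by simpa using h)

theorem isDOp_relabel {m m' : Type} [Fintype m] [Fintype m'] (e : m ≃ m') :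
    IsDOp (relabel e) := by
  refine isDOp_of_isCP (fun r X hX => ?_) fun X _ => ?_
  · exact hX.submatrix (Prod.map e.symm id)
  · refine le_of_eq (congrArg Complex.re ?_)
    exact Equiv.sum_comp e.symm fun i => X i i

/-! ## Closure properties of LOCC -/

theorem comp_finsetSum {m m' m'' ι : Type} [Fintype ι] (G : Superop m' m'')
    (F : ι → Superop m m') : G ∘ₗ (∑ i, F i) = ∑ i, G ∘ₗ F i := by
  ext1 X
  simp

/-- Induction on the map applied first: its rounds stay in front, and its final product of local
operations is reinterpreted as two one-outcome rounds preceding `G`. -/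
theorem IsLOCC.comp {m n m' n' m'' n'' : Type} [Fintype m] [Fintype n] [Fintype m'] [Fintype n']
    [Fintype m''] [Fintype n''] {G : Superop (m' × n') (m'' × n'')}
    {F : Superop (m × n) (m' × n')} (hG : IsLOCC G) (hF : IsLOCC F) : IsLOCC (G ∘ₗ F) := by
  induction hF with
  | local_op Φ Ψ hΦ hΨ =>
    have h1 := IsLOCC.alice 1 (fun _ => Φ) (fun _ => G) hΦ.isSignedInstrument (fun _ => hG)
    have h2 := IsLOCC.bob 1 (fun _ => Ψ) (fun _ => _) hΨ.isSignedInstrument (fun _ => h1)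
    simpa [tensorOp, LinearMap.comp_assoc] using h2
  | alice r E R hE _ ih =>
    have := IsLOCC.alice r E _ hE ih
    simpa [comp_finsetSum, LinearMap.comp_assoc] using this
  | bob r E R hE _ ih =>
    have := IsLOCC.bob r E _ hE ih
    simpa [comp_finsetSum, LinearMap.comp_assoc] using this

theorem extend_sum {m n m' n' ι : Type} [Fintype ι] (r s : Type)
    (F : ι → Superop (m × n) (m' × n')) : extend r s (∑ i, F i) = ∑ i, extend r s (F i) := by
  ext1 X
  simp [extend, ampRight_sum]

theorem IsLOCC.extend {m n m' n' : Type} [Fintype m] [Fintype n] [Fintype m'] [Fintype n']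
    (r s : Type) [Fintype r] [Fintype s] {F : Superop (m × n) (m' × n')} (hF : IsLOCC F) :
    IsLOCC (extend r s F) := by
  induction hF with
  -- Both sides unfold to the same blockwise formula, so regrouping the ancillas with their owners
  -- holds by definition here and in the two cases below.
  | local_op Φ Ψ hΦ hΨ => exact IsLOCC.local_op _ _ (hΦ.ampRight r) (hΨ.ampRight s)
  | alice k E R hE _ ih =>
    rw [extend_sum]
    exact IsLOCC.alice k _ _ (hE.ampRight r) ih
  | bob k E R hE _ ih =>
    rw [extend_sum]
    exact IsLOCC.bob k _ _ (hE.ampRight s) ih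

theorem isLOCC_relabel {m n m' n' : Type} [Fintype m] [Fintype n] [Fintype m'] [Fintype n']
    (e : m ≃ m') (f : n ≃ n') : IsLOCC (relabel (Equiv.prodCongr e f)) :=
  IsLOCC.local_op (relabel e) (relabel f) (isDOp_relabel e) (isDOp_relabel f)

/-! ## Product inputs and linear witnesses -/

theorem ampRight_kronecker {m m' n : Type} (Φ : Superop m m') (x : Matrix m m ℂ)
    (y : Matrix n n ℂ) : ampRight n Φ (x ⊗ₖ y) = Φ x ⊗ₖ y := by
  ext p q
  have : (Matrix.of fun i j => (x ⊗ₖ y) (i, p.2) (j, q.2)) = y p.2 q.2 • x := by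
    ext i j
    simp [mul_comm]
  rw [ampRight_apply, this, map_smul]
  simp [mul_comm]

theorem ampLeft_kronecker {m n n' : Type} (Φ : Superop n n') (x : Matrix m m ℂ)
    (y : Matrix n n ℂ) : ampLeft m Φ (x ⊗ₖ y) = x ⊗ₖ Φ y := by
  ext p q
  have : (Matrix.of fun i j => (x ⊗ₖ y) (p.1, i) (q.1, j)) = x p.1 q.1 • y := by
    ext i j
    simp
  rw [ampLeft_apply, this, map_smul]
  simp

theorem tensorOp_kronecker {m m' n n' : Type} (Φ : Superop m m') (Ψ : Superop n n')
    (x : Matrix m m ℂ) (y : Matrix n n ℂ) : tensorOp Φ Ψ (x ⊗ₖ y) = Φ x ⊗ₖ Ψ y := by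
  rw [tensorOp, LinearMap.comp_apply, ampLeft_kronecker, ampRight_kronecker]

theorem trace_re_nonneg {m : Type} [Fintype m] {x : Matrix m m ℂ} (hx : x.PosSemidef) :
    0 ≤ x.trace.re :=
  (Complex.nonneg_iff.mp hx.trace_nonneg).1

theorem trace_re_sum_le {m m' : Type} [Fintype m] [Fintype m'] {r : ℕ}
    {P N : Fin r → Superop m m'} (h : TraceNonincreasing (∑ j, (P j + N j)))
    {x : Matrix m m ℂ} (hx : x.PosSemidef) :
    ∑ j, ((P j x).trace.re + (N j x).trace.re) ≤ x.trace.re := by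
  have := h x hx
  simpa [LinearMap.sum_apply, Matrix.trace_sum, Matrix.trace_add] using this

/-- A linear functional of norm at most one on product states has this property also after an LOCC
map. -/
theorem IsLOCC.norm_apply_kronecker_le {m n m' n' : Type} [Fintype m] [Fintype n] [Fintype m']
    [Fintype n'] {F : Superop (m × n) (m' × n')} (hF : IsLOCC F)
    {ω : Matrix (m' × n') (m' × n') ℂ →ₗ[ℂ] ℂ}
    (hω : ∀ (x : Matrix m' m' ℂ) (y : Matrix n' n' ℂ), x.PosSemidef → y.PosSemidef →
      ‖ω (x ⊗ₖ y)‖ ≤ x.trace.re * y.trace.re) {x : Matrix m m ℂ} {y : Matrix n n ℂ}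
    (hx : x.PosSemidef) (hy : y.PosSemidef) : ‖ω (F (x ⊗ₖ y))‖ ≤ x.trace.re * y.trace.re := by
  induction hF with
  | local_op Φ Ψ hΦ hΨ =>
    obtain ⟨P, N, hP, hN, ht, rfl⟩ := hΦ
    obtain ⟨P', N', hP', hN', ht', rfl⟩ := hΨ
    have h1 := ht x hx
    have h2 := ht' y hy
    simp only [LinearMap.add_apply, Matrix.trace_add, Complex.add_re] at h1 h2
    have e : ω (tensorOp (P - N) (P' - N') (x ⊗ₖ y)) =
        ω (P x ⊗ₖ P' y) - ω (P x ⊗ₖ N' y) - (ω (N x ⊗ₖ P' y) - ω (N x ⊗ₖ N' y)) := by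
      rw [tensorOp_kronecker, ← map_sub, ← map_sub, ← map_sub]
      congr 1
      ext p q
      simp
      ring
    have b1 := hω _ _ (hP.posSemidef hx) (hP'.posSemidef hy)
    have b2 := hω _ _ (hP.posSemidef hx) (hN'.posSemidef hy)
    have b3 := hω _ _ (hN.posSemidef hx) (hP'.posSemidef hy)
    have b4 := hω _ _ (hN.posSemidef hx) (hN'.posSemidef hy)
    have c1 := trace_re_nonneg (hP.posSemidef hx)
    have c2 := trace_re_nonneg (hN.posSemidef hx)
    have c3 := trace_re_nonneg (hP'.posSemidef hy)
    have c4 := trace_re_nonneg (hN'.posSemidef hy)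
    rw [e]
    -- The triangle inequality replaces every sign by a plus, and the four terms factor into `tr (P
    -- + N) x` times `tr (P' + N') y`. This is why signs give no advantage against the witness.
    calc _ ≤ ‖ω (P x ⊗ₖ P' y)‖ + ‖ω (P x ⊗ₖ N' y)‖ +
          (‖ω (N x ⊗ₖ P' y)‖ + ‖ω (N x ⊗ₖ N' y)‖) :=
          (norm_sub_le _ _).trans (add_le_add (norm_sub_le _ _) (norm_sub_le _ _))
      _ ≤ ((P x).trace.re + (N x).trace.re) * ((P' y).trace.re + (N' y).trace.re) := by linarith
      _ ≤ _ := mul_le_mul h1 h2 (by positivity) (trace_re_nonneg hx)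
  | alice r E R hE _ ih =>
    obtain ⟨P, N, hP, hN, ht, hE⟩ := hE
    have hy0 := trace_re_nonneg hy
    -- Each branch sends a product to a product of positive operators, so the induction hypothesis
    -- applies to both parts of every branch.
    have e : ω ((∑ j, R j ∘ₗ ampRight _ (E j)) (x ⊗ₖ y)) =
        ∑ j, (ω (R j (P j x ⊗ₖ y)) - ω (R j (N j x ⊗ₖ y))) := by
      simp only [LinearMap.sum_apply, map_sum, LinearMap.comp_apply, ampRight_kronecker]
      refine Finset.sum_congr rfl fun j _ => ?_
      rw [← map_sub, ← map_sub, hE]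
      congr 2
      ext p q
      simp
      ring
    rw [e]
    calc _ ≤ ∑ j, (‖ω (R j (P j x ⊗ₖ y))‖ + ‖ω (R j (N j x ⊗ₖ y))‖) :=
          (norm_sum_le _ _).trans (Finset.sum_le_sum fun j _ => norm_sub_le _ _)
      _ ≤ ∑ j, ((P j x).trace.re + (N j x).trace.re) * y.trace.re := by
          refine Finset.sum_le_sum fun j _ => ?_
          rw [add_mul]
          exact add_le_add (ih j ((hP j).posSemidef hx) hy) (ih j ((hN j).posSemidef hx) hy)
      _ ≤ _ := by
          rw [← Finset.sum_mul]
          exact mul_le_mul_of_nonneg_right (trace_re_sum_le ht hx) hy0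
  | bob r E R hE _ ih =>
    obtain ⟨P, N, hP, hN, ht, hE⟩ := hE
    have hx0 := trace_re_nonneg hx
    have e : ω ((∑ j, R j ∘ₗ ampLeft _ (E j)) (x ⊗ₖ y)) =
        ∑ j, (ω (R j (x ⊗ₖ P j y)) - ω (R j (x ⊗ₖ N j y))) := by
      simp only [LinearMap.sum_apply, map_sum, LinearMap.comp_apply, ampLeft_kronecker]
      refine Finset.sum_congr rfl fun j _ => ?_
      rw [← map_sub, ← map_sub, hE]
      congr 2
      ext p q
      simp
      ring
    rw [e]
    calc _ ≤ ∑ j, (‖ω (R j (x ⊗ₖ P j y))‖ + ‖ω (R j (x ⊗ₖ N j y))‖) :=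
          (norm_sum_le _ _).trans (Finset.sum_le_sum fun j _ => norm_sub_le _ _)
      _ ≤ ∑ j, x.trace.re * ((P j y).trace.re + (N j y).trace.re) := by
          refine Finset.sum_le_sum fun j _ => ?_
          rw [mul_add]
          exact add_le_add (ih j hx ((hP j).posSemidef hy)) (ih j hx ((hN j).posSemidef hy))
      _ ≤ _ := by
          rw [← Finset.mul_sum]
          exact mul_le_mul_of_nonneg_left (trace_re_sum_le ht hy) hx0

/-! ## Schmidt decompositions -/

/-- `ψ = ∑ₛ αₛ |eₛ⟩ ⊗ |fₛ⟩` with `αₛ ≥ 0` and orthonormal families `e` and `f`. -/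
structure IsSchmidt {m n ι : Type} [Fintype m] [Fintype n] [Fintype ι] [DecidableEq ι]
    (ψ : m × n → ℂ) (α : ι → ℝ) (e : ι → m → ℂ) (f : ι → n → ℂ) : Prop where
  nonneg : ∀ s, 0 ≤ α s
  orth_left : ∀ s t, ∑ i, star (e s i) * e t i = if s = t then 1 else 0
  orth_right : ∀ s t, ∑ j, star (f s j) * f t j = if s = t then 1 else 0
  eq : ∀ i j, ψ (i, j) = ∑ s, (α s : ℂ) * (e s i * f s j)

theorem orthonormal_toLp_iff {m ι : Type} [Fintype m] [DecidableEq ι] {e : ι → m → ℂ} :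
    Orthonormal ℂ (fun s => WithLp.toLp 2 (e s)) ↔
      ∀ s t, ∑ i, star (e s i) * e t i = if s = t then 1 else 0 := by
  rw [orthonormal_iff_ite]
  simp [PiLp.inner_apply, mul_comm]

theorem HasSchmidtCoefficients.exists_isSchmidt {m n : Type} [Fintype m] [Fintype n]
    {ψ : m × n → ℂ} {r : ℕ} {α : Fin r → ℝ} (h : HasSchmidtCoefficients ψ α) :
    ∃ e f, IsSchmidt ψ α e f := by
  obtain ⟨h0, e, f, he, hf, h⟩ := h
  exact ⟨fun s i => e s i, fun s j => f s j, h0, orthonormal_toLp_iff.mp he,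
    orthonormal_toLp_iff.mp hf, h⟩

/-- Bessel's inequality. -/
theorem sum_normSq_inner_le {m ι : Type} [Fintype m] [Fintype ι] [DecidableEq ι] {e : ι → m → ℂ}
    (he : ∀ s t, ∑ i, star (e s i) * e t i = if s = t then 1 else 0) (v : m → ℂ) :
    ∑ s, ‖∑ i, star (e s i) * v i‖ ^ 2 ≤ ∑ i, ‖v i‖ ^ 2 := by
  have := (orthonormal_toLp_iff.mpr he).sum_inner_products_le (WithLp.toLp 2 v)
    (s := Finset.univ)
  simpa [PiLp.inner_apply, EuclideanSpace.norm_sq_eq, mul_comm] using this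

theorem sum_star_mul_of_orthonormal {m ι : Type} [Fintype m] [Fintype ι] [DecidableEq ι]
    {e : ι → m → ℂ} (he : ∀ s t, ∑ i, star (e s i) * e t i = if s = t then 1 else 0)
    (c d : ι → ℂ) :
    ∑ i, star (∑ s, c s * e s i) * (∑ s, d s * e s i) = ∑ s, star (c s) * d s := by
  calc _ = ∑ s, ∑ t, star (c s) * d t * ∑ i, star (e s i) * e t i := by
        simp_rw [star_sum, star_mul', Finset.sum_mul_sum, Finset.mul_sum]
        rw [Finset.sum_comm]
        refine Finset.sum_congr rfl fun s _ => ?_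
        rw [Finset.sum_comm]
        refine Finset.sum_congr rfl fun t _ => Finset.sum_congr rfl fun i _ => by ring
    _ = _ := by simp_rw [he]; simp

section Schmidt

variable {m n ι : Type} [Fintype m] [Fintype n] [Fintype ι] [DecidableEq ι]
  {ψ : m × n → ℂ} {α : ι → ℝ} {e : ι → m → ℂ} {f : ι → n → ℂ}

theorem IsSchmidt.orth_prod (h : IsSchmidt ψ α e f) (s t : ι) :
    ∑ x : m × n, star (e s x.1 * f s x.2) * (e t x.1 * f t x.2) = if s = t then 1 else 0 := by
  have : ∑ x : m × n, star (e s x.1 * f s x.2) * (e t x.1 * f t x.2) =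
      (∑ i, star (e s i) * e t i) * ∑ j, star (f s j) * f t j := by
    rw [Finset.sum_mul_sum, Fintype.sum_prod_type]
    refine Finset.sum_congr rfl fun i _ => Finset.sum_congr rfl fun j _ => ?_
    rw [star_mul']
    ring
  rw [this, h.orth_left, h.orth_right]
  split_ifs <;> simp

/-- Needed for two choices of `c`: `c = α` gives the normalization `∑ α² = 1`, and `c = 1` gives the
overlap `∑ α` with the witness vector. -/
theorem IsSchmidt.sum_star_mul (h : IsSchmidt ψ α e f) (c : ι → ℂ) :
    ∑ x : m × n, star (∑ s, c s * (e s x.1 * f s x.2)) * ψ x = ∑ s, star (c s) * α s := by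
  have hψ : ψ = fun x => ∑ s, (α s : ℂ) * (e s x.1 * f s x.2) := funext fun x => h.eq x.1 x.2
  rw [hψ]
  exact sum_star_mul_of_orthonormal h.orth_prod c _

theorem IsSchmidt.sum_sq (h : IsSchmidt ψ α e f) (hψ : ∑ x, star (ψ x) * ψ x = 1) :
    ∑ s, α s ^ 2 = 1 := by
  have h1 := h.sum_star_mul fun s => (α s : ℂ)
  have h2 : ψ = fun x => ∑ s, (α s : ℂ) * (e s x.1 * f s x.2) := funext fun x => h.eq x.1 x.2
  rw [show (∑ x : m × n, star (∑ s, (α s : ℂ) * (e s x.1 * f s x.2)) * ψ x) =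
    ∑ x, star (ψ x) * ψ x from Finset.sum_congr rfl fun x _ => by rw [h2], hψ] at h1
  apply Complex.ofReal_injective
  rw [Complex.ofReal_one, h1]
  simp [pow_two]

theorem IsSchmidt.sum_nonneg (h : IsSchmidt ψ α e f) : 0 ≤ ∑ s, α s :=
  Finset.sum_nonneg fun s _ => h.nonneg s

theorem IsSchmidt.one_le_sum_sq (h : IsSchmidt ψ α e f) (hψ : ∑ x, star (ψ x) * ψ x = 1) :
    1 ≤ (∑ s, α s) ^ 2 := by
  rw [← h.sum_sq hψ]
  exact Finset.sum_sq_le_sq_sum_of_nonneg fun s _ => h.nonneg s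

theorem IsSchmidt.one_le_sum (h : IsSchmidt ψ α e f) (hψ : ∑ x, star (ψ x) * ψ x = 1) :
    1 ≤ ∑ s, α s := by
  have := h.one_le_sum_sq hψ
  nlinarith [h.sum_nonneg]

end Schmidt

/-! ## The lower bound -/

-- Write `x = B* B` and take the conjugated rows of `B`; this allows bounds on product states to be
-- checked on pure products.
open scoped MatrixOrder Matrix.Norms.L2Operator in
theorem exists_eq_sum_proj {m : Type} [Fintype m] {x : Matrix m m ℂ} (hx : x.PosSemidef) :
    ∃ v : m → m → ℂ, x = ∑ k, proj (v k) := by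
  classical
  obtain ⟨B, rfl⟩ := CStarAlgebra.nonneg_iff_eq_star_mul_self.mp hx.nonneg
  refine ⟨fun k i => star (B k i), ?_⟩
  ext i j
  simp [Matrix.mul_apply, Matrix.sum_apply, proj, Matrix.vecMulVec_apply, Matrix.star_apply]

theorem trace_proj {m : Type} [Fintype m] (v : m → ℂ) :
    (proj v).trace = ((∑ i, ‖v i‖ ^ 2 : ℝ) : ℂ) := by
  simp [proj, Matrix.trace, Matrix.vecMulVec_apply, Complex.mul_conj']

theorem trace_proj' {m : Type} [Fintype m] (v : m → ℂ) :
    (proj v).trace = ∑ i, star (v i) * v i := by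
  simp [proj, Matrix.trace, Matrix.vecMulVec_apply, mul_comm]

theorem norm_apply_kronecker_le_of_proj {m n : Type} [Fintype m] [Fintype n]
    {ω : Matrix (m × n) (m × n) ℂ →ₗ[ℂ] ℂ}
    (hω : ∀ (v : m → ℂ) (w : n → ℂ), ‖ω (proj v ⊗ₖ proj w)‖ ≤
      (∑ i, ‖v i‖ ^ 2) * ∑ j, ‖w j‖ ^ 2)
    (x : Matrix m m ℂ) (y : Matrix n n ℂ) (hx : x.PosSemidef) (hy : y.PosSemidef) :
    ‖ω (x ⊗ₖ y)‖ ≤ x.trace.re * y.trace.re := by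
  obtain ⟨v, rfl⟩ := exists_eq_sum_proj hx
  obtain ⟨w, rfl⟩ := exists_eq_sum_proj hy
  have e : (∑ k, proj (v k)) ⊗ₖ (∑ l, proj (w l)) = ∑ k, ∑ l, proj (v k) ⊗ₖ proj (w l) := by
    ext p q
    simp [Matrix.sum_apply, Finset.sum_mul_sum]
  simp only [e, map_sum, Matrix.trace_sum, trace_proj, Complex.re_sum, Complex.ofReal_re,
    Finset.sum_mul_sum _ _ (fun k => ∑ i, ‖v k i‖ ^ 2)]
  refine (norm_sum_le _ _).trans (Finset.sum_le_sum fun k _ => ?_)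
  exact (norm_sum_le _ _).trans (Finset.sum_le_sum fun l _ => hω _ _)

/-- The functional `Z ↦ 2 ⟨φ|Z|φ⟩ - tr Z`. -/
def witness {m : Type} [Fintype m] (φ : m → ℂ) : Matrix m m ℂ →ₗ[ℂ] ℂ where
  toFun Z := 2 * (star φ ⬝ᵥ Z.mulVec φ) - Z.trace
  map_add' X Y := by
    rw [Matrix.add_mulVec, dotProduct_add, Matrix.trace_add]
    ring
  map_smul' c X := by
    rw [Matrix.smul_mulVec, dotProduct_smul, Matrix.trace_smul]
    simp
    ring

theorem witness_proj {m : Type} [Fintype m] (φ ψ : m → ℂ) :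
    witness φ (proj ψ) = ((2 * ‖∑ i, star (φ i) * ψ i‖ ^ 2 - ∑ i, ‖ψ i‖ ^ 2 : ℝ) : ℂ) := by
  have : star φ ⬝ᵥ (proj ψ).mulVec φ =
      ((‖∑ i, star (φ i) * ψ i‖ ^ 2 : ℝ) : ℂ) := by
    rw [proj, Matrix.vecMulVec_mulVec, dotProduct_smul, Complex.ofReal_pow, ← Complex.mul_conj']
    simp [dotProduct, mul_comm]
  change 2 * (star φ ⬝ᵥ (proj ψ).mulVec φ) - (proj ψ).trace = _
  rw [this, trace_proj]
  push_cast
  ring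

theorem proj_kronecker_proj {m n : Type} (v : m → ℂ) (w : n → ℂ) :
    proj v ⊗ₖ proj w = proj fun x : m × n => v x.1 * w x.2 := by
  ext p q
  simp [proj, Matrix.vecMulVec_apply]
  ring

/-- Cauchy–Schwarz over the Schmidt index followed by Bessel on each side bounds the squared overlap
by the squared norm of the product vector. Doubling and subtracting that norm centres the range, so
the bound is two-sided, as the signed maps require. The vector is deliberately not normalized. -/
theorem norm_witness_proj_kronecker_le {m n ι : Type} [Fintype m] [Fintype n] [Fintype ι]
    [DecidableEq ι] {e : ι → m → ℂ} {f : ι → n → ℂ}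
    (he : ∀ s t, ∑ i, star (e s i) * e t i = if s = t then 1 else 0)
    (hf : ∀ s t, ∑ j, star (f s j) * f t j = if s = t then 1 else 0) (v : m → ℂ) (w : n → ℂ) :
    ‖witness (fun x : m × n => ∑ s, e s x.1 * f s x.2) (proj v ⊗ₖ proj w)‖ ≤
      (∑ i, ‖v i‖ ^ 2) * ∑ j, ‖w j‖ ^ 2 := by
  rw [proj_kronecker_proj, witness_proj, Complex.norm_real, Real.norm_eq_abs]
  have h1 : ∑ x : m × n, ‖v x.1 * w x.2‖ ^ 2 = (∑ i, ‖v i‖ ^ 2) * ∑ j, ‖w j‖ ^ 2 := by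
    simp [Fintype.sum_prod_type, Finset.sum_mul_sum, mul_pow]
  have h2 : ∑ x : m × n, star (∑ s, e s x.1 * f s x.2) * (v x.1 * w x.2) =
      ∑ s, (∑ i, star (e s i) * v i) * ∑ j, star (f s j) * w j := by
    simp_rw [Finset.sum_mul_sum, Fintype.sum_prod_type, star_sum, Finset.sum_mul, star_mul']
    symm
    rw [Finset.sum_comm]
    refine Finset.sum_congr rfl fun i _ => ?_
    rw [Finset.sum_comm]
    exact Finset.sum_congr rfl fun j _ => Finset.sum_congr rfl fun s _ => by ring
  have h3 : ‖∑ s, (∑ i, star (e s i) * v i) * ∑ j, star (f s j) * w j‖ ^ 2 ≤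
      (∑ i, ‖v i‖ ^ 2) * ∑ j, ‖w j‖ ^ 2 := by
    calc _ ≤ (∑ s, ‖∑ i, star (e s i) * v i‖ * ‖∑ j, star (f s j) * w j‖) ^ 2 := by
          refine pow_le_pow_left₀ (norm_nonneg _) ((norm_sum_le _ _).trans_eq ?_) 2
          simp only [norm_mul]
      _ ≤ _ := Finset.sum_mul_sq_le_sq_mul_sq _ _ _
      _ ≤ _ := mul_le_mul (sum_normSq_inner_le he v) (sum_normSq_inner_le hf w)
          (Finset.sum_nonneg fun _ _ => by positivity) (Finset.sum_nonneg fun _ _ => by positivity)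
  rw [h1, h2, abs_le]
  constructor
  · linarith [sq_nonneg ‖∑ s, (∑ i, star (e s i) * v i) * ∑ j, star (f s j) * w j‖]
  · linarith

section LowerBound

variable {m n m' n' ι : Type} [Fintype m] [Fintype n] [Fintype m'] [Fintype n'] [Fintype ι]
  [DecidableEq ι]

/-- The γ-factor of a map that turns a product state into a pure state. -/
theorem IsSchmidt.le_gammaLOCC {ψ : m' × n' → ℂ} {α : ι → ℝ} {e : ι → m' → ℂ} {f : ι → n' → ℂ}
    (h : IsSchmidt ψ α e f) (hψ : ∑ x, star (ψ x) * ψ x = 1) {Φ : Superop (m × n) (m' × n')}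
    {x : Matrix m m ℂ} {y : Matrix n n ℂ} (hx : x.PosSemidef) (hy : y.PosSemidef)
    (hx1 : x.trace = 1) (hy1 : y.trace = 1) (hΦ : Φ (x ⊗ₖ y) = proj ψ) :
    ENNReal.ofReal (2 * (∑ s, α s) ^ 2 - 1) ≤ gammaLOCC Φ := by
  refine le_sInf ?_
  rintro κ ⟨N, -, a, F, hF, rfl, rfl⟩
  refine ENNReal.ofReal_le_ofReal ?_
  set φ : m' × n' → ℂ := fun x => ∑ s, e s x.1 * f s x.2
  have hb := norm_apply_kronecker_le_of_proj (norm_witness_proj_kronecker_le h.orth_left h.orth_right)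
  have h1 : ∑ x, star (φ x) * ψ x = ((∑ s, α s : ℝ) : ℂ) := by
    have := h.sum_star_mul fun _ => 1
    simpa [φ] using this
  have h2 : ∑ x, ‖ψ x‖ ^ 2 = 1 := by
    apply Complex.ofReal_injective
    rw [← trace_proj, trace_proj', hψ, Complex.ofReal_one]
  -- The value reached on the target, against at most one for each LOCC term.
  have h3 : witness φ (proj ψ) = ((2 * (∑ s, α s) ^ 2 - 1 : ℝ) : ℂ) := by
    rw [witness_proj, h1, h2, Complex.norm_real, Real.norm_eq_abs, sq_abs]
  have h4 : ‖witness φ (proj ψ)‖ ≤ ∑ i, |a i| := by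
    rw [← hΦ]
    simp only [LinearMap.sum_apply, map_sum, LinearMap.smul_apply, map_smul, smul_eq_mul]
    refine (norm_sum_le _ _).trans (Finset.sum_le_sum fun i _ => ?_)
    rw [norm_mul, Complex.norm_real, Real.norm_eq_abs]
    refine mul_le_of_le_one_right (abs_nonneg _) ?_
    have := (hF i).norm_apply_kronecker_le hb hx hy
    simpa [hx1, hy1] using this
  rw [h3, Complex.norm_real] at h4
  exact (le_abs_self _).trans h4

/-- Local ancillas come for free, which allows a gate to be tested on halves of local maximally
entangled states. -/
theorem gammaLOCC_extend_le (r s : Type) [Fintype r] [Fintype s]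
    (Φ : Superop (m × n) (m' × n')) : gammaLOCC (extend r s Φ) ≤ gammaLOCC Φ := by
  refine sInf_le_sInf ?_
  rintro κ ⟨N, hN, a, F, hF, rfl, rfl⟩
  refine ⟨N, hN, a, fun i => extend r s (F i), fun i => (hF i).extend r s, ?_, rfl⟩
  rw [extend_sum]
  rfl

end LowerBound

theorem posSemidef_proj {m : Type} [Finite m] (v : m → ℂ) : (proj v).PosSemidef :=
  Matrix.posSemidef_vecMulVec_self_star v

theorem zeroState_eq_kronecker (m n : Type) [DecidableEq m] [DecidableEq n] [Zero m] [Zero n] :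
    zeroState m n = proj (Pi.single (0 : m) (1 : ℂ)) ⊗ₖ proj (Pi.single (0 : n) (1 : ℂ)) := by
  ext p q
  obtain ⟨p1, p2⟩ := p
  obtain ⟨q1, q2⟩ := q
  simp [zeroState, proj, Matrix.vecMulVec_apply, Matrix.single_apply, Pi.single_apply]
  grind

theorem trace_proj_single {m : Type} [Fintype m] [DecidableEq m] (i : m) :
    (proj (Pi.single i (1 : ℂ))).trace = 1 := by
  simp [trace_proj', Pi.single_apply]

theorem IsSchmidt.le_gammaLOCCState {m n ι : Type} [Fintype m] [Fintype n] [Fintype ι]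
    [DecidableEq ι] [DecidableEq m] [DecidableEq n] [Zero m] [Zero n]
    {ψ : m × n → ℂ} {α : ι → ℝ} {e : ι → m → ℂ} {f : ι → n → ℂ}
    (h : IsSchmidt ψ α e f) (hψ : ∑ x, star (ψ x) * ψ x = 1) :
    ENNReal.ofReal (2 * (∑ s, α s) ^ 2 - 1) ≤ gammaLOCCState (proj ψ) := by
  refine le_sInf ?_
  rintro κ ⟨Φ, hΦ, rfl⟩
  rw [zeroState_eq_kronecker] at hΦ
  exact h.le_gammaLOCC hψ (posSemidef_proj _) (posSemidef_proj _) (trace_proj_single _)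
    (trace_proj_single _) hΦ

/-! ## Quasiprobability decompositions of pure states into product states -/

theorem star_stdAddChar (z : ZMod 3) :
    star (ZMod.stdAddChar z : ℂ) = ZMod.stdAddChar (-z) :=
  (AddChar.map_neg_eq_conj _ _).symm

/-- Explains the choice of cube roots of unity: with signs alone, the pattern `s = t'`, `s' = t`
would also cancel. Modulo 3 it leaves `2 (θ s - θ s')`, which is not identically zero unless `s =
s'`. -/
theorem forall_phase_eq_zero_iff {ι : Type} [DecidableEq ι] (s s' t t' : ι) :
    (∀ θ : ι → ZMod 3, θ s - θ s' - θ t + θ t' = 0) ↔ (s = t ∧ s' = t') ∨ (s = s' ∧ t = t') := by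
  constructor
  · intro h
    have key : ∀ u v : ι, (∀ θ : ι → ZMod 3, θ u = θ v) → u = v := by
      intro u v huv
      by_contra hne
      have := huv (Pi.single u 1)
      rw [Pi.single_eq_same, Pi.single_eq_of_ne (Ne.symm hne)] at this
      exact absurd this (by decide)
    by_cases h1 : s = t
    · subst h1
      refine Or.inl ⟨rfl, key _ _ fun θ => ?_⟩
      linear_combination -(h θ)
    by_cases h2 : s = s'
    · subst h2
      refine Or.inr ⟨rfl, key _ _ fun θ => ?_⟩
      linear_combination -(h θ)
    exfalso
    have h3 := h (Pi.single s 1)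
    rw [Pi.single_eq_same, Pi.single_eq_of_ne (Ne.symm h1), Pi.single_eq_of_ne (Ne.symm h2)] at h3
    -- Phase one on `s` alone makes the combination 2 or 1, according to whether `t' = s`; neither
    -- vanishes modulo 3.
    by_cases h4 : t' = s
    · subst h4
      rw [Pi.single_eq_same] at h3
      exact absurd h3 (by decide)
    · rw [Pi.single_eq_of_ne h4] at h3
      exact absurd h3 (by decide)
  · rintro (⟨rfl, rfl⟩ | ⟨rfl, rfl⟩) θ <;> ring

section PureState

variable {m n ι : Type} [Fintype m] [Fintype n] [Fintype ι] [DecidableEq ι]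

/-- Orthogonality of characters on `(ZMod 3)^ι`: the sum is the group order if the character is
trivial, and zero otherwise. -/
theorem sum_phases (s s' t t' : ι) :
    ∑ θ : ι → ZMod 3, ((ZMod.stdAddChar (θ s) : ℂ) * star (ZMod.stdAddChar (θ s')) *
      (star (ZMod.stdAddChar (θ t)) * ZMod.stdAddChar (θ t'))) =
    if (s = t ∧ s' = t') ∨ (s = s' ∧ t = t') then (3 : ℂ) ^ Fintype.card ι else 0 := by
  classical
  let g : (ι → ZMod 3) →+ ZMod 3 := Pi.evalAddMonoidHom (fun _ => ZMod 3) s -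
    Pi.evalAddMonoidHom (fun _ => ZMod 3) s' - Pi.evalAddMonoidHom (fun _ => ZMod 3) t +
    Pi.evalAddMonoidHom (fun _ => ZMod 3) t'
  have hg : ∀ θ, g θ = θ s - θ s' - θ t + θ t' := fun θ => rfl
  have h1 := AddChar.sum_eq_ite ((ZMod.stdAddChar (N := 3)).compAddMonoidHom g)
  have h2 : (ZMod.stdAddChar (N := 3)).compAddMonoidHom g = 0 ↔
      (s = t ∧ s' = t') ∨ (s = s' ∧ t = t') := by
    rw [← forall_phase_eq_zero_iff, DFunLike.ext_iff]
    refine forall_congr' fun θ => ?_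
    rw [← hg, AddChar.compAddMonoidHom_apply, AddChar.zero_apply,
      ← (ZMod.stdAddChar (N := 3)).map_zero_eq_one, ZMod.injective_stdAddChar.eq_iff]
  simp only [h2] at h1
  simp only [star_stdAddChar, ← AddChar.map_add_eq_mul]
  refine Eq.trans (Finset.sum_congr rfl fun θ _ => ?_) (h1.trans ?_)
  · rw [AddChar.compAddMonoidHom_apply, hg]
    congr 1
    ring
  · simp

/-- Alice's vector in the product state with phases `θ`. -/
noncomputable def phaseVec (α : ι → ℝ) (e : ι → m → ℂ) (θ : ι → ZMod 3) : m → ℂ :=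
  fun i => ∑ s, ((√(α s) : ℂ) * ZMod.stdAddChar (θ s)) * e s i

theorem norm_stdAddChar_mul (z : ZMod 3) :
    star (ZMod.stdAddChar z : ℂ) * ZMod.stdAddChar z = 1 := by
  rw [star_stdAddChar, ← AddChar.map_add_eq_mul]
  simp

theorem sqrt_mul_self_ofReal {x : ℝ} (hx : 0 ≤ x) : (√x : ℂ) * (√x : ℂ) = x := by
  rw [← Complex.ofReal_mul, Real.mul_self_sqrt hx]

theorem trace_proj_phaseVec {α : ι → ℝ} (hα : ∀ s, 0 ≤ α s) {e : ι → m → ℂ}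
    (he : ∀ s t, ∑ i, star (e s i) * e t i = if s = t then 1 else 0) (θ : ι → ZMod 3) :
    (proj (phaseVec α e θ)).trace = ((∑ s, α s : ℝ) : ℂ) := by
  rw [trace_proj']
  refine (sum_star_mul_of_orthonormal he _ _).trans ?_
  rw [Complex.ofReal_sum]
  refine Finset.sum_congr rfl fun s _ => ?_
  rw [star_mul', ← sqrt_mul_self_ofReal (hα s)]
  have : star (√(α s) : ℂ) = (√(α s) : ℂ) := Complex.conj_ofReal _
  rw [this]
  linear_combination ((√(α s) : ℂ) * (√(α s) : ℂ)) * norm_stdAddChar_mul (θ s)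

theorem sum_mul_four {κ : Type} [Fintype κ] (a b c d : κ → ℂ) :
    (∑ s, a s) * (∑ s, b s) * ((∑ s, c s) * ∑ s, d s) =
      ∑ p : κ × κ × κ × κ, a p.1 * b p.2.1 * (c p.2.2.1 * d p.2.2.2) := by
  simp only [Fintype.sum_prod_type, Finset.sum_mul_sum]
  exact Finset.sum_congr rfl fun s _ => Finset.sum_comm

/-- Expand into ket and bra indices `s, s'` for Alice and `t, t'` for Bob. With opposite phases the
average keeps `s = t, s' = t'`, which assembles `|ψ⟩⟨ψ|`, and `s = s', t = t'`, which gives products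
of Schmidt projectors. -/
theorem sum_proj_phaseVec {ψ : m × n → ℂ} {α : ι → ℝ} {e : ι → m → ℂ} {f : ι → n → ℂ}
    (h : IsSchmidt ψ α e f) :
    ∑ θ : ι → ZMod 3, proj (phaseVec α e θ) ⊗ₖ proj (phaseVec α f (-θ)) =
      (3 : ℂ) ^ Fintype.card ι • (proj ψ + ∑ s, ∑ t,
        (if s = t then 0 else ((α s * α t : ℝ) : ℂ)) • (proj (e s) ⊗ₖ proj (f t))) := by
  ext ⟨i, j⟩ ⟨i', j'⟩
  let C : ι → ι → ι → ι → ℂ := fun s s' t t' => (√(α s) : ℂ) * √(α s') * (√(α t) * √(α t')) *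
    (e s i * star (e s' i') * (f t j * star (f t' j')))
  have h1 : ∀ θ : ι → ZMod 3,
      (proj (phaseVec α e θ) ⊗ₖ proj (phaseVec α f (-θ))) (i, j) (i', j') =
      ∑ p : ι × ι × ι × ι, C p.1 p.2.1 p.2.2.1 p.2.2.2 *
        ((ZMod.stdAddChar (θ p.1) : ℂ) * star (ZMod.stdAddChar (θ p.2.1)) *
        (star (ZMod.stdAddChar (θ p.2.2.1)) * ZMod.stdAddChar (θ p.2.2.2))) := by
    intro θ
    simp only [Matrix.kroneckerMap_apply, proj, Matrix.vecMulVec_apply, Pi.star_apply, phaseVec,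
      star_sum]
    rw [sum_mul_four]
    refine Finset.sum_congr rfl fun p _ => ?_
    simp only [star_mul', Pi.neg_apply, ← star_stdAddChar, star_star, C]
    have hr : ∀ x : ℝ, star (x : ℂ) = x := Complex.conj_ofReal
    simp only [hr]
    ring
  have h2 : ∑ p : ι × ι × ι × ι, C p.1 p.2.1 p.2.2.1 p.2.2.2 *
      (if (p.1 = p.2.2.1 ∧ p.2.1 = p.2.2.2) ∨ (p.1 = p.2.1 ∧ p.2.2.1 = p.2.2.2) then
        (3 : ℂ) ^ Fintype.card ι else 0) =
      (3 : ℂ) ^ Fintype.card ι * (∑ s, ∑ s', C s s' s s' +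
        ∑ s, ∑ t, if s = t then 0 else C s s t t) := by
    -- The two surviving patterns meet when all four indices agree. That term is assigned to `ψ`, so
    -- the remainder runs over `s ≠ t` only.
    have : ∀ s s' t t' : ι, C s s' t t' * (if (s = t ∧ s' = t') ∨ (s = s' ∧ t = t') then
        (3 : ℂ) ^ Fintype.card ι else 0) = (3 : ℂ) ^ Fintype.card ι *
        ((if s = t then if s' = t' then C s s' t t' else 0 else 0) +
          if s = s' then if t = t' then if s = t then 0 else C s s' t t' else 0 else 0) := by
      intro s s' t t'
      split_ifs <;> first | (exfalso; grind) | simp [mul_comm]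
    simp only [Fintype.sum_prod_type, this, ← Finset.mul_sum, Finset.sum_add_distrib]
    simp [Finset.sum_ite_irrel]
  have h3 : ∀ s s', C s s' s s' = (α s * (e s i * f s j)) * star (α s' * (e s' i' * f s' j')) := by
    intro s s'
    have hr : ∀ x : ℝ, star (x : ℂ) = x := Complex.conj_ofReal
    simp only [C, star_mul', hr]
    rw [← sqrt_mul_self_ofReal (h.nonneg s), ← sqrt_mul_self_ofReal (h.nonneg s')]
    ring
  have h4 : ∀ s t, C s s t t = ((α s * α t : ℝ) : ℂ) *
      (e s i * star (e s i') * (f t j * star (f t j'))) := by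
    intro s t
    simp only [C]
    rw [Complex.ofReal_mul, ← sqrt_mul_self_ofReal (h.nonneg s),
      ← sqrt_mul_self_ofReal (h.nonneg t)]
  rw [Matrix.sum_apply]
  simp only [h1]
  rw [Finset.sum_comm]
  simp only [← Finset.mul_sum, sum_phases]
  rw [h2]
  simp only [h3, h4, Matrix.smul_apply, Matrix.add_apply, Matrix.sum_apply, smul_eq_mul,
    Matrix.kroneckerMap_apply, proj, Matrix.vecMulVec_apply, Pi.star_apply, h.eq, star_sum,
    Finset.sum_mul_sum, ite_mul, zero_mul]

/-- The optimal decomposition of a pure state into product states. -/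
theorem IsSchmidt.exists_product_decomposition {ψ : m × n → ℂ} {α : ι → ℝ} {e : ι → m → ℂ}
    {f : ι → n → ℂ} (h : IsSchmidt ψ α e f) (hψ : ∑ x, star (ψ x) * ψ x = 1) :
    ∃ (N : ℕ) (a : Fin N → ℝ) (x : Fin N → Matrix m m ℂ) (y : Fin N → Matrix n n ℂ),
      1 ≤ N ∧ (∀ i, (x i).PosSemidef ∧ (x i).trace = 1) ∧
      (∀ i, (y i).PosSemidef ∧ (y i).trace = 1) ∧
      proj ψ = ∑ i, (a i : ℂ) • (x i ⊗ₖ y i) ∧ ∑ i, |a i| = 2 * (∑ s, α s) ^ 2 - 1 := by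
  set A := ∑ s, α s with hA
  have hA1 : 1 ≤ A := h.one_le_sum hψ
  have hA0 : (A : ℂ) ≠ 0 := Complex.ofReal_ne_zero.mpr (by linarith)
  let κ := (ι → ZMod 3) ⊕ (ι × ι)
  -- Each phase vector has squared norm `A`, so normalizing both sides and averaging over `3^|ι|`
  -- phases gives weights of total `A²`. The subtracted products cost `∑_{s ≠ t} α s α t = A² - 1`;
  -- diagonal pairs remain in the index type with weight zero.
  let a : κ → ℝ := Sum.elim (fun _ => A ^ 2 / 3 ^ Fintype.card ι)
    fun p => if p.1 = p.2 then 0 else -(α p.1 * α p.2)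
  let x : κ → Matrix m m ℂ := Sum.elim (fun θ => ((A⁻¹ : ℝ) : ℂ) • proj (phaseVec α e θ))
    fun p => proj (e p.1)
  let y : κ → Matrix n n ℂ := Sum.elim (fun θ => ((A⁻¹ : ℝ) : ℂ) • proj (phaseVec α f (-θ)))
    fun p => proj (f p.2)
  have hinv : (0 : ℂ) ≤ ((A⁻¹ : ℝ) : ℂ) := by
    rw [Complex.zero_le_real]
    positivity
  have hx : ∀ k, (x k).PosSemidef ∧ (x k).trace = 1 := by
    rintro (θ | p)
    · refine ⟨(posSemidef_proj _).smul hinv, ?_⟩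
      simp only [x, Sum.elim_inl]
      rw [Matrix.trace_smul, trace_proj_phaseVec h.nonneg h.orth_left, ← hA]
      simp [hA0]
    · refine ⟨posSemidef_proj _, ?_⟩
      simp only [x, Sum.elim_inr]
      rw [trace_proj', h.orth_left, if_pos rfl]
  have hy : ∀ k, (y k).PosSemidef ∧ (y k).trace = 1 := by
    rintro (θ | p)
    · refine ⟨(posSemidef_proj _).smul hinv, ?_⟩
      simp only [y, Sum.elim_inl]
      rw [Matrix.trace_smul, trace_proj_phaseVec h.nonneg h.orth_right, ← hA]
      simp [hA0]
    · refine ⟨posSemidef_proj _, ?_⟩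
      simp only [y, Sum.elim_inr]
      rw [trace_proj', h.orth_right, if_pos rfl]
  have hsum : proj ψ = ∑ k, (a k : ℂ) • (x k ⊗ₖ y k) := by
    have h1 : ∀ θ : ι → ZMod 3, ((A ^ 2 / 3 ^ Fintype.card ι : ℝ) : ℂ) •
        ((((A⁻¹ : ℝ) : ℂ) • proj (phaseVec α e θ)) ⊗ₖ
          (((A⁻¹ : ℝ) : ℂ) • proj (phaseVec α f (-θ)))) = ((3 : ℂ) ^ Fintype.card ι)⁻¹ •
        (proj (phaseVec α e θ) ⊗ₖ proj (phaseVec α f (-θ))) := by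
      intro θ
      rw [Matrix.smul_kronecker, Matrix.kronecker_smul, smul_smul, smul_smul]
      congr 1
      push_cast
      field_simp
    have h2 : ∀ p : ι × ι, ((if p.1 = p.2 then 0 else -(α p.1 * α p.2) : ℝ) : ℂ) •
        (proj (e p.1) ⊗ₖ proj (f p.2)) = -((if p.1 = p.2 then 0 else ((α p.1 * α p.2 : ℝ) : ℂ)) •
        (proj (e p.1) ⊗ₖ proj (f p.2))) := by
      intro p
      split_ifs <;> simp
    simp only [κ, Fintype.sum_sum_type, a, x, y, Sum.elim_inl, Sum.elim_inr, h1, h2,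
      ← Finset.smul_sum, sum_proj_phaseVec h, Finset.sum_neg_distrib]
    rw [smul_smul, inv_mul_cancel₀ (by positivity), one_smul, Fintype.sum_prod_type]
    simp
  have habs : ∑ k, |a k| = 2 * A ^ 2 - 1 := by
    have h1 : ∀ p : ι × ι, |if p.1 = p.2 then 0 else -(α p.1 * α p.2)| =
        α p.1 * α p.2 - if p.1 = p.2 then α p.1 * α p.2 else 0 := by
      intro p
      have := mul_nonneg (h.nonneg p.1) (h.nonneg p.2)
      split_ifs <;> simp [abs_of_nonneg (h.nonneg _)]
    simp only [κ, Fintype.sum_sum_type, a, Sum.elim_inl, Sum.elim_inr, h1,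
      Finset.sum_sub_distrib, Fintype.sum_prod_type, Finset.sum_ite_eq, Finset.mem_univ, if_true]
    rw [← Finset.sum_mul_sum, ← hA]
    have h2 : ∑ s, α s * α s = 1 := by simpa [pow_two] using h.sum_sq hψ
    rw [h2, abs_of_nonneg (by positivity)]
    simp
    field_simp
    ring
  let E := Fintype.equivFin κ
  refine ⟨Fintype.card κ, a ∘ E.symm, x ∘ E.symm, y ∘ E.symm, Fintype.card_pos,
    fun i => hx _, fun i => hy _, ?_, ?_⟩
  · rw [hsum]
    exact (Equiv.sum_comp E.symm fun k => (a k : ℂ) • (x k ⊗ₖ y k)).symm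
  · rw [← habs]
    exact Equiv.sum_comp E.symm fun k => |a k|

end PureState

/-! ## Preparing and attaching local states -/

/-- The superoperator `ρ ↦ ρ ⊗ x`. -/
def attachLocal {p : Type} (m : Type) (x : Matrix p p ℂ) : Superop m (m × p) where
  toFun ρ := ρ ⊗ₖ x
  map_add' ρ σ := Matrix.add_kronecker ρ σ x
  map_smul' c ρ := Matrix.smul_kronecker c ρ x

/-- The superoperator `ρ ↦ tr(ρ) x`. -/
def prepare {p : Type} (m : Type) [Fintype m] (x : Matrix p p ℂ) : Superop m p where
  toFun ρ := ρ.trace • x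
  map_add' ρ σ := by rw [Matrix.trace_add, add_smul]
  map_smul' c ρ := by rw [Matrix.trace_smul, smul_assoc, RingHom.id_apply]

theorem isDOp_attachLocal {m p : Type} [Fintype m] [Fintype p] {x : Matrix p p ℂ}
    (hx : x.PosSemidef) (hx1 : x.trace = 1) : IsDOp (attachLocal m x) := by
  classical
  obtain ⟨v, hv⟩ := exists_eq_sum_proj hx
  refine isDOp_of_isCP ?_ fun X _ => ?_
  -- The Kraus operators are `1 ⊗ |v k⟩`.
  · have : attachLocal m x = ∑ k, kraus (Matrix.of fun (i : m × p) (j : m) =>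
        if i.1 = j then v k i.2 else 0) := by
      ext1 ρ
      ext i j
      simp [attachLocal, hv, LinearMap.sum_apply, Matrix.sum_apply, kraus_apply, Matrix.mul_apply,
        proj, Matrix.vecMulVec_apply, Finset.mul_sum, apply_ite (starRingEnd ℂ)]
      exact Finset.sum_congr rfl fun k _ => by ring
    rw [this]
    exact IsCP.sum fun k => isCP_kraus _
  · change (X ⊗ₖ x).trace.re ≤ _
    rw [Matrix.trace_kronecker, hx1, mul_one]

theorem isDOp_prepare {m p : Type} [Fintype m] [Fintype p] {x : Matrix p p ℂ}
    (hx : x.PosSemidef) (hx1 : x.trace = 1) : IsDOp (prepare m x) := by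
  classical
  obtain ⟨v, hv⟩ := exists_eq_sum_proj hx
  refine isDOp_of_isCP ?_ fun X _ => ?_
  -- The Kraus operators are `|v k⟩⟨l|`: measure the input in the basis, discard the outcome,
  -- prepare `v k`.
  · have : prepare m x = ∑ q : p × m, kraus (Matrix.vecMulVec (v q.1) (Pi.single q.2 (1 : ℂ))) := by
      ext1 ρ
      ext i j
      simp [prepare, hv, LinearMap.sum_apply, Matrix.sum_apply, kraus_apply, Matrix.mul_apply,
        proj, Matrix.vecMulVec_apply, Finset.mul_sum,
        Fintype.sum_prod_type, Matrix.trace, Pi.single_apply, Finset.sum_mul]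
      refine Finset.sum_congr rfl fun k _ => Finset.sum_congr rfl fun l _ => by ring
    rw [this]
    exact IsCP.sum fun k => isCP_kraus _
  · change (X.trace • x).trace.re ≤ _
    rw [Matrix.trace_smul, hx1, smul_eq_mul, mul_one]

theorem attach_kronecker {m n p q : Type} (x : Matrix p p ℂ) (y : Matrix q q ℂ) :
    attach m n (x ⊗ₖ y) = tensorOp (attachLocal m x) (attachLocal n y) := by
  ext1 ρ
  ext i j
  simp [attach, tensorOp, ampRight_apply, ampLeft_apply, attachLocal]
  ring

theorem isLOCC_attach_kronecker {m n p q : Type} [Fintype m] [Fintype n] [Fintype p] [Fintype q]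
    {x : Matrix p p ℂ} {y : Matrix q q ℂ} (hx : x.PosSemidef) (hx1 : x.trace = 1)
    (hy : y.PosSemidef) (hy1 : y.trace = 1) : IsLOCC (attach m n (x ⊗ₖ y)) := by
  rw [attach_kronecker]
  exact IsLOCC.local_op _ _ (isDOp_attachLocal hx hx1) (isDOp_attachLocal hy hy1)

theorem isLOCC_prepare {m n p q : Type} [Fintype m] [Fintype n] [Fintype p] [Fintype q]
    {x : Matrix p p ℂ} {y : Matrix q q ℂ} (hx : x.PosSemidef) (hx1 : x.trace = 1)
    (hy : y.PosSemidef) (hy1 : y.trace = 1) : IsLOCC (tensorOp (prepare m x) (prepare n y)) :=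
  IsLOCC.local_op _ _ (isDOp_prepare hx hx1) (isDOp_prepare hy hy1)

theorem prepare_zeroState {m n p q : Type} [Fintype m] [Fintype n] [DecidableEq m] [DecidableEq n]
    [Zero m] [Zero n] (x : Matrix p p ℂ) (y : Matrix q q ℂ) :
    tensorOp (prepare m x) (prepare n y) (zeroState m n) = x ⊗ₖ y := by
  rw [zeroState_eq_kronecker, tensorOp_kronecker]
  simp [prepare, trace_proj_single]

theorem attach_sum_smul {m n p q : Type} {N : ℕ} (a : Fin N → ℂ)
    (τ : Fin N → Matrix (p × q) (p × q) ℂ) :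
    attach m n (∑ i, a i • τ i) = ∑ i, a i • attach m n (τ i) := by
  ext1 ρ
  ext i j
  simp only [attach, LinearMap.coe_mk, AddHom.coe_mk, Matrix.of_apply, Matrix.sum_apply,
    Matrix.smul_apply, smul_eq_mul, LinearMap.sum_apply, LinearMap.smul_apply, Finset.mul_sum]
  exact Finset.sum_congr rfl fun k _ => by ring

/-- The γ-factor of a pure state. -/
theorem IsSchmidt.gammaLOCCState_eq {m n ι : Type} [Fintype m] [Fintype n] [Fintype ι]
    [DecidableEq ι] [DecidableEq m] [DecidableEq n] [Zero m] [Zero n]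
    {ψ : m × n → ℂ} {α : ι → ℝ} {e : ι → m → ℂ} {f : ι → n → ℂ}
    (h : IsSchmidt ψ α e f) (hψ : ∑ x, star (ψ x) * ψ x = 1) :
    gammaLOCCState (proj ψ) = ENNReal.ofReal (2 * (∑ s, α s) ^ 2 - 1) ∧
      gammaLOCCState (proj ψ) ∈ statePrepCosts (proj ψ) := by
  obtain ⟨N, a, x, y, hN, hx, hy, hdec, hsum⟩ := h.exists_product_decomposition hψ
  let Φ : Superop (m × n) (m × n) :=
    ∑ i, (a i : ℂ) • tensorOp (prepare m (x i)) (prepare n (y i))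
  have hΦ : Φ (zeroState m n) = proj ψ := by
    simp [Φ, prepare_zeroState, hdec]
  -- Replacing the input by the product states of the decomposition defines one superoperator whose
  -- cost meets the lower bound; it is therefore a minimizer.
  have hle : gammaLOCC Φ ≤ ENNReal.ofReal (2 * (∑ s, α s) ^ 2 - 1) :=
    sInf_le ⟨N, hN, a, _, fun i => isLOCC_prepare (hx i).1 (hx i).2 (hy i).1 (hy i).2, rfl,
      by rw [hsum]⟩
  have hmem : gammaLOCC Φ ∈ statePrepCosts (proj ψ) := ⟨Φ, hΦ, rfl⟩
  have hlow := h.le_gammaLOCCState hψ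
  have hle' : gammaLOCCState (proj ψ) ≤ gammaLOCC Φ := sInf_le hmem
  have heq : gammaLOCCState (proj ψ) = gammaLOCC Φ := le_antisymm hle' (hle.trans hlow)
  exact ⟨le_antisymm (hle'.trans hle) hlow, heq ▸ hmem⟩

/-! ## Simulation of circuits by gadgets -/

/-- A map that does not touch the memory sees its input only multiplied by an entry of `σ`, so it
commutes with attaching the memory. -/
theorem extend_comp_attach {m n m' n' p q : Type} (σ : Matrix (p × q) (p × q) ℂ)
    (F : Superop (m × n) (m' × n')) :
    extend p q F ∘ₗ attach m n σ = attach m' n' σ ∘ₗ F := by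
  ext1 ρ
  ext i j
  have : (Matrix.of fun k l => ρ k l * σ (i.1.2, i.2.2) (j.1.2, j.2.2)) =
      σ (i.1.2, i.2.2) (j.1.2, j.2.2) • ρ := by
    ext k l
    simp [mul_comm]
  change F (Matrix.of fun k l => ρ k l * σ (i.1.2, i.2.2) (j.1.2, j.2.2))
      (i.1.1, i.2.1) (j.1.1, j.2.1) =
    F ρ (i.1.1, i.2.1) (j.1.1, j.2.1) * σ (i.1.2, i.2.2) (j.1.2, j.2.2)
  rw [this, map_smul]
  simp [mul_comm]

/-- The entries of `τ^{⊗(k+1)}` factor into those of the first cell, which `T` consumes, and those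
of the remaining cells, which it does not see. -/
theorem consumeCell_comp_attach {m n c d p q : Type} (T : Superop ((m × p) × (n × q)) (m × n))
    (τ : Matrix (p × q) (p × q) ℂ) (k : ℕ) :
    consumeCell T k ∘ₗ attach (m × c) (n × d) (tensorPow (k + 1) τ) =
      attach (m × c) (n × d) (tensorPow k τ) ∘ₗ extend c d (T ∘ₗ attach m n τ) := by
  ext1 ρ
  ext i j
  obtain ⟨⟨⟨i1, ic⟩, ip⟩, ⟨⟨i2, id⟩, iq⟩⟩ := i
  obtain ⟨⟨⟨j1, jc⟩, jp⟩, ⟨⟨j2, jd⟩, jq⟩⟩ := j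
  have : (Matrix.of fun (u v : (m × p) × (n × q)) =>
      ρ ((u.1.1, ic), (u.2.1, id)) ((v.1.1, jc), (v.2.1, jd)) *
        tensorPow (k + 1) τ (Fin.cons u.1.2 ip, Fin.cons u.2.2 iq)
          (Fin.cons v.1.2 jp, Fin.cons v.2.2 jq)) =
      tensorPow k τ (ip, iq) (jp, jq) • attach m n τ (Matrix.of fun u v =>
        ρ ((u.1, ic), (u.2, id)) ((v.1, jc), (v.2, jd))) := by
    ext u v
    simp only [Matrix.of_apply, tensorPow, attach, Matrix.smul_apply, smul_eq_mul,
      LinearMap.coe_mk, AddHom.coe_mk, Fin.prod_univ_succ, Fin.cons_zero, Fin.cons_succ]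
    ring
  change T (Matrix.of fun (u v : (m × p) × (n × q)) =>
      ρ ((u.1.1, ic), (u.2.1, id)) ((v.1.1, jc), (v.2.1, jd)) *
        tensorPow (k + 1) τ (Fin.cons u.1.2 ip, Fin.cons u.2.2 iq)
          (Fin.cons v.1.2 jp, Fin.cons v.2.2 jq)) (i1, i2) (j1, j2) =
    T (attach m n τ (Matrix.of fun u v =>
      ρ ((u.1, ic), (u.2, id)) ((v.1, jc), (v.2, jd)))) (i1, i2) (j1, j2) *
        tensorPow k τ (ip, iq) (jp, jq)
  rw [this, map_smul]
  simp [mul_comm]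

/-- The memory is moved past the first LOCC map, one cell is turned into `U`, and the rest is
induction. The exact identity on `τ^{⊗k}` is what linearity later distributes over a
quasiprobability decomposition of the memory. -/
theorem gadgetCircuit_comp_attach {m n c d p q : Type} [Fintype m] [Fintype n]
    {U : Matrix (m × n) (m × n) ℂ} {T : Superop ((m × p) × (n × q)) (m × n)}
    {τ : Matrix (p × q) (p × q) ℂ} (hT : ∀ ρ, T (attach m n τ ρ) = unitaryChannel U ρ) (k : ℕ)
    (G : ℕ → Superop ((m × c) × (n × d)) ((m × c) × (n × d))) :
    gadgetCircuit T k G ∘ₗ attach (m × c) (n × d) (tensorPow k τ) = gateCircuit U k G := by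
  induction k generalizing G with
  | zero =>
    have : relabel (Equiv.prodCongr (Equiv.prodUnique (m × c) (Fin 0 → p))
        (Equiv.prodUnique (n × d) (Fin 0 → q))) ∘ₗ
          attach (m × c) (n × d) (tensorPow 0 τ) = LinearMap.id := by
      ext1 ρ
      ext i j
      simp [relabel, attach, tensorPow]
    rw [gadgetCircuit, LinearMap.comp_assoc, this, LinearMap.comp_id, gateCircuit]
  | succ k ih =>
    have hT' : T ∘ₗ attach m n τ = unitaryChannel U := LinearMap.ext hT
    rw [gadgetCircuit, LinearMap.comp_assoc, LinearMap.comp_assoc, extend_comp_attach,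
      ← LinearMap.comp_assoc _ _ (consumeCell T k), consumeCell_comp_attach, hT',
      LinearMap.comp_assoc, ← LinearMap.comp_assoc, ih, gateCircuit]

theorem isLOCC_gadgetCircuit {m n c d p q : Type} [Fintype m] [Fintype n] [Fintype c] [Fintype d]
    [Fintype p] [Fintype q] {T : Superop ((m × p) × (n × q)) (m × n)} (hT : IsLOCC T) (k : ℕ)
    {G : ℕ → Superop ((m × c) × (n × d)) ((m × c) × (n × d))} (hG : ∀ j, IsLOCC (G j)) :
    IsLOCC (gadgetCircuit T k G) := by
  induction k generalizing G with
  | zero => exact (hG 0).comp (isLOCC_relabel _ _)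
  | succ k ih =>
    refine (ih fun j => hG (j + 1)).comp (IsLOCC.comp ?_ ((hG 0).extend _ _))
    exact (isLOCC_relabel _ _).comp ((hT.extend _ _).comp (isLOCC_relabel _ _))

/-! ## Tensor powers of Schmidt decompositions -/

theorem sum_star_prod {m : Type} [Fintype m] {k : ℕ} {ι : Type} [DecidableEq ι] {e : ι → m → ℂ}
    (he : ∀ s t, ∑ i, star (e s i) * e t i = if s = t then 1 else 0) (σ τ : Fin k → ι) :
    ∑ x : Fin k → m, star (∏ j, e (σ j) (x j)) * ∏ j, e (τ j) (x j) = if σ = τ then 1 else 0 := by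
  have : ∀ x : Fin k → m, star (∏ j, e (σ j) (x j)) * ∏ j, e (τ j) (x j) =
      ∏ j, star (e (σ j) (x j)) * e (τ j) (x j) := fun x => by
    rw [star_prod, Finset.prod_mul_distrib]
  simp only [this]
  rw [← Fintype.prod_sum fun j i => star (e (σ j) i) * e (τ j) i]
  simp only [he]
  split_ifs with h
  · simp [h]
  · obtain ⟨j, hj⟩ := Function.ne_iff.mp h
    exact Finset.prod_eq_zero (Finset.mem_univ j) (if_neg hj)

/-- Multiplicativity of the Schmidt sum, the source of the exponent `2k` in the γ-factor. -/
theorem sum_prod_pow {k : ℕ} {ι : Type} [Fintype ι] (α : ι → ℝ) :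
    ∑ σ : Fin k → ι, ∏ j, α (σ j) = (∑ s, α s) ^ k := by
  rw [← Fintype.prod_sum fun _ => α]
  simp

/-- The amplitudes of a tensor power. -/
def vecPow {m n : Type} (k : ℕ) (ψ : m × n → ℂ) : (Fin k → m) × (Fin k → n) → ℂ :=
  fun x => ∏ j, ψ (x.1 j, x.2 j)

theorem tensorPow_proj {m n : Type} (k : ℕ) (ψ : m × n → ℂ) :
    tensorPow k (proj ψ) = proj (vecPow k ψ) := by
  ext x y
  simp [tensorPow, proj, Matrix.vecMulVec_apply, vecPow, Finset.prod_mul_distrib]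

theorem IsSchmidt.vecPow {m n ι : Type} [Fintype m] [Fintype n] [Fintype ι] [DecidableEq ι]
    {ψ : m × n → ℂ} {α : ι → ℝ} {e : ι → m → ℂ} {f : ι → n → ℂ} (h : IsSchmidt ψ α e f) (k : ℕ) :
    IsSchmidt (vecPow k ψ) (fun σ : Fin k → ι => ∏ j, α (σ j))
      (fun σ x => ∏ j, e (σ j) (x j)) (fun σ y => ∏ j, f (σ j) (y j)) where
  nonneg σ := Finset.prod_nonneg fun j _ => h.nonneg _
  orth_left := sum_star_prod h.orth_left
  orth_right := sum_star_prod h.orth_right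
  eq x y := by
    simp only [_root_.vecPow, h.eq]
    rw [Fintype.prod_sum fun j s => (α s : ℂ) * (e s (x j) * f s (y j))]
    refine Finset.sum_congr rfl fun σ _ => ?_
    rw [Finset.prod_mul_distrib, Finset.prod_mul_distrib, Complex.ofReal_prod]

theorem sum_star_vecPow {m n : Type} [Fintype m] [Fintype n] (k : ℕ) {ψ : m × n → ℂ}
    (hψ : ∑ x, star (ψ x) * ψ x = 1) : ∑ x, star (vecPow k ψ x) * vecPow k ψ x = 1 := by
  have h := sum_star_prod (k := k) (e := fun _ : Unit => ψ) (by simpa using hψ) (fun _ => ()) fun _ => ()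
  rw [if_pos rfl] at h
  rw [← h]
  exact Fintype.sum_equiv (Equiv.arrowProdEquivProdArrow (Fin k) _ _).symm _ _ fun x => rfl

/-- A gadget that implements `U` with a pure resource state gives an optimal simulation of circuits
with `k` gates. -/
theorem IsSchmidt.teleportationAchieves {m n p q ι : Type} [Fintype m] [Fintype n] [Fintype p]
    [Fintype q] [DecidableEq p] [DecidableEq q] [Zero p] [Zero q] [Fintype ι] [DecidableEq ι]
    {U : Matrix (m × n) (m × n) ℂ} {T : Superop ((m × p) × (n × q)) (m × n)}
    {ψ : p × q → ℂ} {α : ι → ℝ} {e : ι → p → ℂ} {f : ι → q → ℂ} (h : IsSchmidt ψ α e f)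
    (hψ : ∑ x, star (ψ x) * ψ x = 1) (hT : IsLOCC T)
    (hTU : ∀ ρ, T (attach m n (proj ψ) ρ) = unitaryChannel U ρ) :
    TeleportationAchieves U (proj ψ) fun k => 2 * (∑ s, α s) ^ (2 * k) - 1 := by
  refine ⟨T, hT, hTU, fun k _ => ?_⟩
  obtain ⟨N, a, x, y, -, hx, hy, hdec, hsum⟩ :=
    (h.vecPow k).exists_product_decomposition (sum_star_vecPow k hψ)
  refine ⟨N, a, fun i => tensorOp (prepare _ (x i)) (prepare _ (y i)),
    fun i => isLOCC_prepare (hx i).1 (hx i).2 (hy i).1 (hy i).2, ?_, ?_, fun c d G hG => ⟨fun i => ?_, ?_⟩⟩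
  · rw [hsum, sum_prod_pow, ← pow_mul, mul_comm k]
  · simp only [prepare_zeroState, tensorPow_proj, hdec]
  · rw [prepare_zeroState]
    exact (isLOCC_gadgetCircuit hT k hG).comp
      (isLOCC_attach_kronecker (hx i).1 (hx i).2 (hy i).1 (hy i).2)
  · simp only [prepare_zeroState]
    rw [← gadgetCircuit_comp_attach hTU, tensorPow_proj, hdec, attach_sum_smul, comp_finsetSum]
    simp only [LinearMap.comp_smul]

/-- A gadget that implements `U` with a pure resource state bounds the γ-factor of `U`. -/
theorem IsSchmidt.mem_qpdCosts {m n p q ι : Type} [Fintype m] [Fintype n] [Fintype p]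
    [Fintype q] [Fintype ι] [DecidableEq ι]
    {U : Matrix (m × n) (m × n) ℂ} {T : Superop ((m × p) × (n × q)) (m × n)}
    {ψ : p × q → ℂ} {α : ι → ℝ} {e : ι → p → ℂ} {f : ι → q → ℂ} (h : IsSchmidt ψ α e f)
    (hψ : ∑ x, star (ψ x) * ψ x = 1) (hT : IsLOCC T)
    (hTU : ∀ ρ, T (attach m n (proj ψ) ρ) = unitaryChannel U ρ) :
    ENNReal.ofReal (2 * (∑ s, α s) ^ 2 - 1) ∈ qpdCosts (unitaryChannel U) := by
  obtain ⟨N, a, x, y, hN, hx, hy, hdec, hsum⟩ := h.exists_product_decomposition hψ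
  refine ⟨N, hN, a, fun i => T ∘ₗ attach m n (x i ⊗ₖ y i), fun i =>
    hT.comp (isLOCC_attach_kronecker (hx i).1 (hx i).2 (hy i).1 (hy i).2), ?_, by rw [hsum]⟩
  have hT' : T ∘ₗ attach m n (proj ψ) = unitaryChannel U := LinearMap.ext hTU
  rw [← hT', hdec, attach_sum_smul, comp_finsetSum]
  simp only [LinearMap.comp_smul]

/-! ## Choi states -/

theorem choi_apply {m n : Type} [Fintype m] [Fintype n] [DecidableEq m] [DecidableEq n]
    (U : Matrix (m × n) (m × n) ℂ) (x : (m × m) × (n × n)) :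
    choi U x = U (x.1.1, x.2.1) (x.1.2, x.2.2) *
      (((√(Fintype.card m) : ℝ) : ℂ)⁻¹ * ((√(Fintype.card n) : ℝ) : ℂ)⁻¹) := by
  simp [choi, maxEnt, Fintype.sum_prod_type]

theorem sqrt_natCast_mul_self (d : ℕ) : ((√d : ℝ) : ℂ) * ((√d : ℝ) : ℂ) = d := by
  rw [sqrt_mul_self_ofReal (Nat.cast_nonneg d), Complex.ofReal_natCast]

theorem inv_sqrt_natCast_mul_self (d : ℕ) :
    ((√d : ℝ) : ℂ)⁻¹ * ((√d : ℝ) : ℂ)⁻¹ = (d : ℂ)⁻¹ := by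
  rw [← mul_inv, sqrt_natCast_mul_self]

theorem sum_star_maxEnt (m : Type) [Fintype m] [DecidableEq m] [Nonempty m] :
    ∑ x, star (maxEnt m x) * maxEnt m x = 1 := by
  have h0 : (Fintype.card m : ℂ) ≠ 0 := Nat.cast_ne_zero.mpr Fintype.card_ne_zero
  simp [maxEnt, Fintype.sum_prod_type, inv_sqrt_natCast_mul_self, h0, apply_ite (starRingEnd ℂ)]

/-- The input is a product across the cut `AA' : BB'`, so any simulation of `U` also prepares its
Choi state from a product. -/
theorem extend_unitaryChannel_maxEnt {m n : Type} [Fintype m] [Fintype n] [DecidableEq m]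
    [DecidableEq n] (U : Matrix (m × n) (m × n) ℂ) :
    extend m n (unitaryChannel U) (proj (maxEnt m) ⊗ₖ proj (maxEnt n)) = proj (choi U) := by
  ext x y
  let u : m × n → (m × m) × (n × n) → ℂ := fun z w => maxEnt m (z.1, w.1.2) * maxEnt n (z.2, w.2.2)
  have h1 : ∀ w, choi U w = (U.mulVec fun z => u z w) (w.1.1, w.2.1) := fun w => rfl
  have h2 : (Matrix.of fun i j : m × n => (proj (maxEnt m) ⊗ₖ proj (maxEnt n))
      ((i.1, x.1.2), (i.2, x.2.2)) ((j.1, y.1.2), (j.2, y.2.2))) =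
      Matrix.vecMulVec (fun z => u z x) (star fun z => u z y) := by
    ext i j
    simp [proj, Matrix.vecMulVec_apply, u]
    ring
  change (U * (Matrix.of fun i j : m × n => (proj (maxEnt m) ⊗ₖ proj (maxEnt n))
      ((i.1, x.1.2), (i.2, x.2.2)) ((j.1, y.1.2), (j.2, y.2.2))) * U.conjTranspose)
      (x.1.1, x.2.1) (y.1.1, y.2.1) = _
  rw [h2, Matrix.mul_vecMulVec, Matrix.vecMulVec_mul, Matrix.vecMul_conjTranspose, star_star]
  simp [proj, Matrix.vecMulVec_apply, h1]

/-- The squared norm is `tr (U† U)` divided by the total dimension. -/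
theorem sum_star_choi {m n : Type} [Fintype m] [Fintype n] [DecidableEq m] [DecidableEq n]
    [Nonempty m] [Nonempty n] {U : Matrix (m × n) (m × n) ℂ}
    (hU : U ∈ Matrix.unitaryGroup (m × n) ℂ) : ∑ x, star (choi U x) * choi U x = 1 := by
  have h0 : (Fintype.card m : ℂ) ≠ 0 := Nat.cast_ne_zero.mpr Fintype.card_ne_zero
  have h1 : (Fintype.card n : ℂ) ≠ 0 := Nat.cast_ne_zero.mpr Fintype.card_ne_zero
  have h2 : (U.conjTranspose * U).trace = (Fintype.card m * Fintype.card n : ℂ) := by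
    rw [← Matrix.star_eq_conjTranspose, Matrix.mem_unitaryGroup_iff'.mp hU, Matrix.trace_one]
    simp
  have h3 : ∑ x, star (choi U x) * choi U x = ∑ x : (m × m) × (n × n),
      ((Fintype.card m : ℂ)⁻¹ * (Fintype.card n : ℂ)⁻¹) *
        (star (U (x.1.1, x.2.1) (x.1.2, x.2.2)) * U (x.1.1, x.2.1) (x.1.2, x.2.2)) := by
    refine Finset.sum_congr rfl fun x _ => ?_
    rw [choi_apply, ← inv_sqrt_natCast_mul_self, ← inv_sqrt_natCast_mul_self]
    simp
    ring
  rw [h3, ← Finset.mul_sum]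
  have h4 : ∑ x : (m × m) × (n × n), star (U (x.1.1, x.2.1) (x.1.2, x.2.2)) *
      U (x.1.1, x.2.1) (x.1.2, x.2.2) = (U.conjTranspose * U).trace := by
    simp only [Matrix.trace, Matrix.diag, Matrix.mul_apply, Matrix.conjTranspose_apply]
    rw [Finset.sum_comm, ← Fintype.sum_prod_type']
    exact Fintype.sum_equiv (Equiv.prodProdProdComm m m n n) _ _ fun x => rfl
  rw [h4, h2]
  field_simp

/-- The γ-factor of a unitary is at least that of its Choi state. -/
theorem IsSchmidt.le_gammaLOCC_unitaryChannel {m n ι : Type} [Fintype m] [Fintype n]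
    [DecidableEq m] [DecidableEq n] [Nonempty m] [Nonempty n] [Fintype ι] [DecidableEq ι]
    {U : Matrix (m × n) (m × n) ℂ} (hU : U ∈ Matrix.unitaryGroup (m × n) ℂ)
    {α : ι → ℝ} {e : ι → m × m → ℂ} {f : ι → n × n → ℂ} (h : IsSchmidt (choi U) α e f) :
    ENNReal.ofReal (2 * (∑ s, α s) ^ 2 - 1) ≤ gammaLOCC (unitaryChannel U) :=
  (h.le_gammaLOCC (sum_star_choi hU) (posSemidef_proj _) (posSemidef_proj _)
    ((trace_proj' _).trans (sum_star_maxEnt m)) ((trace_proj' _).trans (sum_star_maxEnt n))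
    (extend_unitaryChannel_maxEnt U)).trans (gammaLOCC_extend_le m n _)

theorem IsSchmidt.comp_equiv {m n m' n' ι : Type} [Fintype m] [Fintype n] [Fintype m']
    [Fintype n'] [Fintype ι] [DecidableEq ι] {ψ : m × n → ℂ} {α : ι → ℝ} {e : ι → m → ℂ}
    {f : ι → n → ℂ} (h : IsSchmidt ψ α e f) (g : m' ≃ m) (k : n' ≃ n) :
    IsSchmidt (fun x => ψ (g x.1, k x.2)) α (fun s i => e s (g i)) (fun s j => f s (k j)) where
  nonneg := h.nonneg
  orth_left s t := by
    rw [← h.orth_left]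
    exact Equiv.sum_comp g fun i => star (e s i) * e t i
  orth_right s t := by
    rw [← h.orth_right]
    exact Equiv.sum_comp k fun j => star (f s j) * f t j
  eq i j := h.eq _ _

theorem sqrt_card_pow (m : Type) [Fintype m] (k : ℕ) :
    ((√(Fintype.card (Fin k → m)) : ℝ) : ℂ)⁻¹ = (((√(Fintype.card m) : ℝ) : ℂ)⁻¹) ^ k := by
  rw [Fintype.card_fun, Fintype.card_fin, Nat.cast_pow, Real.sqrt_eq_rpow, ← Real.rpow_natCast,
    ← Real.rpow_mul (Nat.cast_nonneg _), mul_comm, Real.rpow_mul (Nat.cast_nonneg _),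
    Real.rpow_natCast, ← Real.sqrt_eq_rpow, Complex.ofReal_pow, inv_pow]

/-- The two vectors differ only by a reshuffling within each party, which leaves the Schmidt
coefficients unchanged. -/
theorem choi_tensorPow {m n : Type} [Fintype m] [Fintype n] [DecidableEq m] [DecidableEq n]
    (U : Matrix (m × n) (m × n) ℂ) (k : ℕ) :
    choi (tensorPow k U) = fun x => vecPow k (choi U)
      ((Equiv.arrowProdEquivProdArrow (Fin k) (fun _ => m) (fun _ => m)).symm x.1,
        (Equiv.arrowProdEquivProdArrow (Fin k) (fun _ => n) (fun _ => n)).symm x.2) := by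
  ext x
  simp only [choi_apply, sqrt_card_pow, vecPow, tensorPow, Matrix.of_apply,
    Finset.prod_mul_distrib, Finset.prod_const, Finset.card_univ, Fintype.card_fin]
  rfl

theorem IsSchmidt.choi_tensorPow {m n ι : Type} [Fintype m] [Fintype n] [DecidableEq m]
    [DecidableEq n] [Fintype ι] [DecidableEq ι] {U : Matrix (m × n) (m × n) ℂ}
    {α : ι → ℝ} {e : ι → m × m → ℂ} {f : ι → n × n → ℂ} (h : IsSchmidt (choi U) α e f) (k : ℕ) :
    ∃ e' f', IsSchmidt (choi (tensorPow k U)) (fun σ : Fin k → ι => ∏ j, α (σ j)) e' f' := by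
  rw [_root_.choi_tensorPow]
  exact ⟨_, _, (h.vecPow k).comp_equiv _ _⟩

/-! ## Unitaries with a product Choi state -/

/-- Partial traces show that both factors are scalar; the trace hypotheses remove the freedom to
move a scalar between them. -/
theorem eq_one_of_kronecker_eq_one {m n : Type} [Fintype m] [Fintype n] [DecidableEq m]
    [DecidableEq n] [Nonempty m] [Nonempty n] {M : Matrix m m ℂ} {N : Matrix n n ℂ}
    (h : M ⊗ₖ N = 1) (hM : M.trace = Fintype.card m) (hN : N.trace = Fintype.card n) :
    M = 1 ∧ N = 1 := by
  have h0 : (Fintype.card m : ℂ) ≠ 0 := Nat.cast_ne_zero.mpr Fintype.card_ne_zero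
  have h1 : (Fintype.card n : ℂ) ≠ 0 := Nat.cast_ne_zero.mpr Fintype.card_ne_zero
  have h2 : ∀ x x' y y', M x x' * N y y' = (1 : Matrix (m × n) (m × n) ℂ) (x, y) (x', y') := by
    intro x x' y y'
    rw [← h]
    rfl
  constructor
  · ext x x'
    have : M x x' * N.trace = (1 : Matrix m m ℂ) x x' * Fintype.card n := by
      simp only [Matrix.trace, Finset.mul_sum, Matrix.diag, h2]
      simp [Matrix.one_apply]
    rw [hN] at this
    exact mul_right_cancel₀ h1 this
  · ext y y'
    have : M.trace * N y y' = Fintype.card m * (1 : Matrix n n ℂ) y y' := by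
      simp only [Matrix.trace, Finset.sum_mul, Matrix.diag, h2]
      simp [Matrix.one_apply]
    rw [hM] at this
    exact mul_left_cancel₀ h0 this

theorem trace_conjTranspose_mul_smul_of {m : Type} [Fintype m] {v : m × m → ℂ}
    (hv : ∑ i, star (v i) * v i = 1) :
    (((((√(Fintype.card m) : ℝ) : ℂ) • Matrix.of fun x x' => v (x, x')).conjTranspose *
      (((√(Fintype.card m) : ℝ) : ℂ) • Matrix.of fun x x' => v (x, x'))).trace : ℂ) =
      Fintype.card m := by
  have h1 : ((Matrix.of fun x x' => v (x, x')).conjTranspose *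
      (Matrix.of fun x x' => v (x, x'))).trace = 1 := by
    rw [← hv, Fintype.sum_prod_type, Finset.sum_comm]
    simp [Matrix.trace, Matrix.mul_apply]
  rw [Matrix.conjTranspose_smul, Matrix.smul_mul, Matrix.mul_smul, smul_smul, Matrix.trace_smul,
    h1]
  have : star ((√(Fintype.card m) : ℝ) : ℂ) = ((√(Fintype.card m) : ℝ) : ℂ) := Complex.conj_ofReal _
  rw [this, sqrt_natCast_mul_self, smul_eq_mul, mul_one]

/-- Reshaping `v` and `w` into matrices factors `U` as `V ⊗ W`. Unitarity of `U` gives `V†V ⊗ W†W =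
1`, and the unit norms of `v` and `w` fix the scalars, so each factor is unitary. -/
theorem not_isEntangling_of_choi_eq_mul {m n : Type} [Fintype m] [Fintype n] [DecidableEq m]
    [DecidableEq n] [Nonempty m] [Nonempty n] {U : Matrix (m × n) (m × n) ℂ}
    (hU : U ∈ Matrix.unitaryGroup (m × n) ℂ) {v : m × m → ℂ} {w : n × n → ℂ}
    (hv : ∑ i, star (v i) * v i = 1) (hw : ∑ j, star (w j) * w j = 1)
    (h : ∀ i j, choi U (i, j) = v i * w j) : ¬ IsEntangling U := by
  have h0 : ((√(Fintype.card m) : ℝ) : ℂ) ≠ 0 := by simp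
  have h1 : ((√(Fintype.card n) : ℝ) : ℂ) ≠ 0 := by simp
  set V : Matrix m m ℂ := ((√(Fintype.card m) : ℝ) : ℂ) • Matrix.of fun x x' => v (x, x')
  set W : Matrix n n ℂ := ((√(Fintype.card n) : ℝ) : ℂ) • Matrix.of fun y y' => w (y, y')
  have hVW : U = V ⊗ₖ W := by
    ext ⟨x, y⟩ ⟨x', y'⟩
    have := h (x, x') (y, y')
    rw [choi_apply] at this
    simp only [V, W, Matrix.kroneckerMap_apply, Matrix.smul_apply, Matrix.of_apply, smul_eq_mul]
    field_simp at this
    linear_combination this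
  have h2 : (V.conjTranspose * V) ⊗ₖ (W.conjTranspose * W) = 1 := by
    rw [Matrix.mul_kronecker_mul, ← Matrix.conjTranspose_kronecker, ← hVW]
    exact Matrix.mem_unitaryGroup_iff'.mp hU
  obtain ⟨h3, h4⟩ := eq_one_of_kronecker_eq_one h2 (trace_conjTranspose_mul_smul_of hv)
    (trace_conjTranspose_mul_smul_of hw)
  exact fun hne => hne ⟨V, Matrix.mem_unitaryGroup_iff'.mpr h3, W,
    Matrix.mem_unitaryGroup_iff'.mpr h4, hVW⟩

/-- If `∑ α = ∑ α² = 1`, then every `α s (1 - α s)` vanishes, so exactly one coefficient is 1 and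
the Choi state is a product. -/
theorem IsSchmidt.one_lt_sum_sq_of_isEntangling {m n ι : Type} [Fintype m] [Fintype n]
    [DecidableEq m] [DecidableEq n] [Nonempty m] [Nonempty n] [Fintype ι] [DecidableEq ι]
    {U : Matrix (m × n) (m × n) ℂ} (hU : U ∈ Matrix.unitaryGroup (m × n) ℂ)
    {α : ι → ℝ} {e : ι → m × m → ℂ} {f : ι → n × n → ℂ} (h : IsSchmidt (choi U) α e f)
    (hE : IsEntangling U) : 1 < (∑ s, α s) ^ 2 := by
  have hψ := sum_star_choi hU
  refine lt_of_le_of_ne (h.one_le_sum_sq hψ) fun heq => ?_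
  have hsum : ∑ s, α s = 1 := by
    have := h.one_le_sum hψ
    nlinarith
  have hle : ∀ s, α s ≤ 1 := fun s =>
    hsum ▸ Finset.single_le_sum (fun t _ => h.nonneg t) (Finset.mem_univ s)
  have h0 : ∑ s, α s * (1 - α s) = 0 := by
    have := h.sum_sq hψ
    simp only [mul_sub, mul_one, Finset.sum_sub_distrib, ← pow_two, this, hsum, sub_self]
  have h1 := (Finset.sum_eq_zero_iff_of_nonneg fun s _ =>
    mul_nonneg (h.nonneg s) (sub_nonneg.mpr (hle s))).mp h0
  obtain ⟨s, -, hs⟩ := Finset.exists_ne_zero_of_sum_ne_zero (hsum ▸ one_ne_zero : ∑ s, α s ≠ 0)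
  have hs1 : α s = 1 := by
    rcases mul_eq_zero.mp (h1 s (Finset.mem_univ s)) with h2 | h2
    · exact absurd h2 hs
    · linarith
  have ht : ∀ t, t ≠ s → α t = 0 := by
    rw [← Finset.add_sum_erase _ _ (Finset.mem_univ s), hs1, add_eq_left] at hsum
    intro t hts
    exact (Finset.sum_eq_zero_iff_of_nonneg fun t _ => h.nonneg t).mp hsum t
      (Finset.mem_erase.mpr ⟨hts, Finset.mem_univ t⟩)
  refine not_isEntangling_of_choi_eq_mul hU (v := e s) (w := f s) ?_ ?_ (fun i j => ?_) hE
  · rw [h.orth_left, if_pos rfl]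
  · rw [h.orth_right, if_pos rfl]
  · rw [h.eq, Finset.sum_eq_single s, hs1, Complex.ofReal_one, one_mul]
    · intro t _ hts
      rw [ht t hts]
      simp
    · simp

/-! ## Gate teleportation -/

/-- A protocol of two measurements and local unitary corrections is LOCC. -/
theorem isLOCC_measure_correct {m n m₁ n₁ S S' : Type} [Fintype m] [Fintype n] [Fintype m₁]
    [Fintype n₁] [Fintype S] [Fintype S'] [DecidableEq m] [DecidableEq n] [DecidableEq m₁]
    [DecidableEq n₁] {K : S → Matrix m₁ m ℂ} {L : S → S' → Matrix n₁ n ℂ}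
    {Q : S → S' → Matrix m₁ m₁ ℂ} {R : S → S' → Matrix n₁ n₁ ℂ}
    (hK : ∑ s, (K s).conjTranspose * K s = 1) (hL : ∀ s, ∑ t, (L s t).conjTranspose * L s t = 1)
    (hQ : ∀ s t, Q s t ∈ Matrix.unitaryGroup m₁ ℂ)
    (hR : ∀ s t, R s t ∈ Matrix.unitaryGroup n₁ ℂ) :
    IsLOCC (∑ s, ∑ t, kraus ((Q s t * K s) ⊗ₖ (R s t * L s t))) := by
  let E := (Fintype.equivFin S).symm
  let E' := (Fintype.equivFin S').symm
  have hQ' := fun s t => isDOp_kraus (Matrix.mem_unitaryGroup_iff'.mp (hQ s t))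
  have hR' := fun s t => isDOp_kraus (Matrix.mem_unitaryGroup_iff'.mp (hR s t))
  have h1 : ∀ s, IsLOCC (∑ t, tensorOp (kraus (Q s t)) (kraus (R s t)) ∘ₗ
      ampLeft m₁ (kraus (L s t))) := by
    intro s
    have := IsLOCC.bob _ (fun j => kraus (L s (E' j)))
      (fun j => tensorOp (kraus (Q s (E' j))) (kraus (R s (E' j))))
      (isSignedInstrument_kraus ((Equiv.sum_comp E' fun t =>
        (L s t).conjTranspose * L s t).trans (hL s)))
      (fun j => IsLOCC.local_op _ _ (hQ' s (E' j)) (hR' s (E' j)))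
    rwa [Equiv.sum_comp E' fun t => tensorOp (kraus (Q s t)) (kraus (R s t)) ∘ₗ
      ampLeft m₁ (kraus (L s t))] at this
  have h2 := IsLOCC.alice _ (fun j => kraus (K (E j))) (fun j => ∑ t,
      tensorOp (kraus (Q (E j) t)) (kraus (R (E j) t)) ∘ₗ ampLeft m₁ (kraus (L (E j) t)))
    (isSignedInstrument_kraus ((Equiv.sum_comp E fun s => (K s).conjTranspose * K s).trans hK))
    (fun j => h1 (E j))
  rw [Equiv.sum_comp E fun s => (∑ t, tensorOp (kraus (Q s t)) (kraus (R s t)) ∘ₗ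
    ampLeft m₁ (kraus (L s t))) ∘ₗ ampRight n (kraus (K s))] at h2
  convert h2 using 1
  refine Finset.sum_congr rfl fun s _ => ?_
  ext1 X
  simp only [LinearMap.sum_apply, LinearMap.comp_apply]
  refine Finset.sum_congr rfl fun t _ => ?_
  rw [tensorOp_kraus, ampLeft_kraus, ampRight_kraus]
  simp only [← LinearMap.comp_apply, kraus_comp, ← Matrix.mul_kronecker_mul,
    Matrix.mul_one, Matrix.one_mul]

/-- The isometry that attaches the pure state `ψ`. -/
def attachVec {p q : Type} (m n : Type) [DecidableEq m] [DecidableEq n] (ψ : p × q → ℂ) :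
    Matrix ((m × p) × (n × q)) (m × n) ℂ :=
  Matrix.of fun x y => if x.1.1 = y.1 ∧ x.2.1 = y.2 then ψ (x.1.2, x.2.2) else 0

theorem attach_proj {m n p q : Type} [Fintype m] [Fintype n] [DecidableEq m] [DecidableEq n]
    (ψ : p × q → ℂ) : attach m n (proj ψ) = kraus (attachVec m n ψ) := by
  ext1 ρ
  ext x y
  simp [attach, proj, Matrix.vecMulVec_apply, kraus_apply, attachVec, Matrix.mul_apply,
    Fintype.sum_prod_type, apply_ite (starRingEnd ℂ), ite_and, Finset.sum_ite_irrel]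
  ring

theorem kronecker_mul_attachVec_apply {m n m₁ n₁ p q : Type} [Fintype m] [Fintype n] [Fintype p]
    [Fintype q] [DecidableEq m] [DecidableEq n] (K : Matrix m₁ (m × p) ℂ)
    (L : Matrix n₁ (n × q) ℂ) (ψ : p × q → ℂ) (i : m₁ × n₁) (j : m × n) :
    (K ⊗ₖ L * attachVec m n ψ) i j =
      ∑ u, ∑ v, K i.1 (j.1, u) * L i.2 (j.2, v) * ψ (u, v) := by
  simp [attachVec, Matrix.mul_apply, Fintype.sum_prod_type, ite_and, Finset.sum_ite_irrel]

/-- If after correction every outcome acts as the same multiple of `U`, the outcome carries no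
information and the branches add up to the channel; `hc` says that their probabilities sum to one.
-/
theorem sum_kraus_attach {m n p q S S' : Type} [Fintype m] [Fintype n] [Fintype p] [Fintype q]
    [DecidableEq m] [DecidableEq n] [Fintype S] [Fintype S'] {U : Matrix (m × n) (m × n) ℂ}
    {ψ : p × q → ℂ} {M : S → S' → Matrix (m × n) ((m × p) × (n × q)) ℂ} {c : ℂ}
    (hM : ∀ s t, M s t * attachVec m n ψ = c • U)
    (hc : (Fintype.card S * Fintype.card S' : ℂ) * (c * star c) = 1) (ρ : Matrix (m × n) (m × n) ℂ) :
    (∑ s, ∑ t, kraus (M s t)) (attach m n (proj ψ) ρ) = unitaryChannel U ρ := by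
  rw [attach_proj, unitaryChannel_eq_kraus]
  simp only [LinearMap.sum_apply]
  simp only [← LinearMap.comp_apply, kraus_comp, hM, kraus_smul]
  simp only [Finset.sum_const, Finset.card_univ, LinearMap.smul_apply]
  rw [← Nat.cast_smul_eq_nsmul ℂ, ← Nat.cast_smul_eq_nsmul ℂ, smul_smul, smul_smul,
    ← mul_assoc, mul_assoc _ c, hc, one_smul]

/-- `P` is a basis of the operators on `m` that is orthogonal with square norms `dim m`. -/
structure IsOperatorBasis {m S : Type} [Fintype m] [DecidableEq m] [Fintype S]
    (P : S → Matrix m m ℂ) : Prop where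
  complete : ∀ x r x' r', ∑ s, P s x r * star (P s x' r') =
    if x = x' ∧ r = r' then (Fintype.card m : ℂ) else 0
  card_eq : Fintype.card S = Fintype.card m ^ 2

/-- The Kraus operators of the measurement in the maximally entangled basis given by `P`, on the
input and the reference of a Choi state. -/
noncomputable def bellKraus {m S : Type} [Fintype m] [DecidableEq m] (P : S → Matrix m m ℂ) (s : S) :
    Matrix m (m × (m × m)) ℂ :=
  Matrix.of fun a x => if a = x.2.1 then
    ((√(Fintype.card m) : ℝ) : ℂ)⁻¹ * star (P s x.1 x.2.2) else 0

theorem IsOperatorBasis.sum_bellKraus {m S : Type} [Fintype m] [DecidableEq m] [Nonempty m]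
    [Fintype S] {P : S → Matrix m m ℂ} (h : IsOperatorBasis P) :
    ∑ s, (bellKraus P s).conjTranspose * bellKraus P s = 1 := by
  have h0 : (Fintype.card m : ℂ) ≠ 0 := Nat.cast_ne_zero.mpr Fintype.card_ne_zero
  ext ⟨x, a, r⟩ ⟨x', a', r'⟩
  have h1 : ∀ s, ((bellKraus P s).conjTranspose * bellKraus P s) (x, a, r) (x', a', r') =
      (if a = a' then (Fintype.card m : ℂ)⁻¹ else 0) * (P s x r * star (P s x' r')) := by
    intro s
    rw [← inv_sqrt_natCast_mul_self]
    simp [bellKraus, Matrix.mul_apply, apply_ite (starRingEnd ℂ)]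
    by_cases haa : a = a'
    · subst haa
      simp
      ring
    · simp [haa, Ne.symm haa]
  simp only [Matrix.sum_apply, h1, ← Finset.mul_sum, h.complete, Matrix.one_apply, Prod.mk.injEq]
  split_ifs <;> simp_all

/-- `U` maps a product operator basis to product unitaries under conjugation. -/
def IsTeleportable {m n : Type} [Fintype m] [Fintype n] [DecidableEq m] [DecidableEq n]
    (U : Matrix (m × n) (m × n) ℂ) : Prop :=
  U ∈ Matrix.unitaryGroup (m × n) ℂ ∧ ∃ (S S' : Type) (_ : Fintype S) (_ : Fintype S')
    (P : S → Matrix m m ℂ) (P' : S' → Matrix n n ℂ), IsOperatorBasis P ∧ IsOperatorBasis P' ∧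
    ∀ s t, ∃ Q ∈ Matrix.unitaryGroup m ℂ, ∃ R ∈ Matrix.unitaryGroup n ℂ,
      U * (P s ⊗ₖ P' t) * U.conjTranspose = Q ⊗ₖ R

/-- The teleportation identity: outcome `(s, t)` leaves `U` applied after the byproduct `(P s ⊗ P'
t)†`, with amplitude `1 / (dim m · dim n)` independent of the outcome and of the input. -/
theorem bellKraus_kronecker_mul_attachVec {m n S S' : Type} [Fintype m] [Fintype n]
    [DecidableEq m] [DecidableEq n] (U : Matrix (m × n) (m × n) ℂ) (P : S → Matrix m m ℂ)
    (P' : S' → Matrix n n ℂ) (s : S) (t : S') :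
    bellKraus P s ⊗ₖ bellKraus P' t * attachVec m n (choi U) =
      ((Fintype.card m : ℂ)⁻¹ * (Fintype.card n : ℂ)⁻¹) •
        (U * (P s ⊗ₖ P' t).conjTranspose) := by
  ext ⟨a, b⟩ ⟨x, y⟩
  rw [kronecker_mul_attachVec_apply, ← inv_sqrt_natCast_mul_self, ← inv_sqrt_natCast_mul_self]
  simp [bellKraus, choi_apply, Fintype.sum_prod_type, Matrix.mul_apply, Finset.sum_ite_irrel,
    Finset.mul_sum]
  exact Finset.sum_congr rfl fun r _ => Finset.sum_congr rfl fun r' _ => by ring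

theorem IsTeleportable.exists_gadget {m n : Type} [Fintype m] [Fintype n] [DecidableEq m]
    [DecidableEq n] [Nonempty m] [Nonempty n] {U : Matrix (m × n) (m × n) ℂ}
    (h : IsTeleportable U) : ∃ T : Superop ((m × (m × m)) × (n × (n × n))) (m × n), IsLOCC T ∧
      ∀ ρ, T (attach m n (proj (choi U)) ρ) = unitaryChannel U ρ := by
  obtain ⟨hU, S, S', _, _, P, P', hP, hP', hQR⟩ := h
  choose Q hQ R hR hQR using hQR
  have h0 : (Fintype.card m : ℂ) ≠ 0 := Nat.cast_ne_zero.mpr Fintype.card_ne_zero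
  have h1 : (Fintype.card n : ℂ) ≠ 0 := Nat.cast_ne_zero.mpr Fintype.card_ne_zero
  refine ⟨_, isLOCC_measure_correct hP.sum_bellKraus (fun _ => hP'.sum_bellKraus) hQ hR,
    sum_kraus_attach (c := (Fintype.card m : ℂ)⁻¹ * (Fintype.card n : ℂ)⁻¹) (fun s t => ?_) ?_⟩
  · have hU1 : U.conjTranspose * U = 1 := Matrix.mem_unitaryGroup_iff'.mp hU
    -- The byproduct is moved through `U` and becomes a product unitary, which the local corrections
    -- `Q` and `R` undo.
    have h2 : U * (P s ⊗ₖ P' t).conjTranspose = (Q s t ⊗ₖ R s t).conjTranspose * U := by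
      rw [← hQR, Matrix.conjTranspose_mul, Matrix.conjTranspose_mul,
        Matrix.conjTranspose_conjTranspose]
      simp only [Matrix.mul_assoc, hU1, Matrix.mul_one]
    have h3 : Q s t ⊗ₖ R s t * (Q s t ⊗ₖ R s t).conjTranspose = 1 := by
      rw [Matrix.conjTranspose_kronecker, ← Matrix.mul_kronecker_mul,
        ← Matrix.star_eq_conjTranspose, ← Matrix.star_eq_conjTranspose,
        Matrix.mem_unitaryGroup_iff.mp (hQ s t), Matrix.mem_unitaryGroup_iff.mp (hR s t),
        Matrix.one_kronecker_one]
    rw [Matrix.mul_kronecker_mul, Matrix.mul_assoc, bellKraus_kronecker_mul_attachVec,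
      Matrix.mul_smul, h2, ← Matrix.mul_assoc, h3, Matrix.one_mul]
  · rw [hP.card_eq, hP'.card_eq]
    simp
    field_simp

/-! ## Tensor products of families of matrices -/

/-- The tensor product of a finite family of matrices. -/
def piMat {m : Type} {k : ℕ} (M : Fin k → Matrix m m ℂ) : Matrix (Fin k → m) (Fin k → m) ℂ :=
  Matrix.of fun x y => ∏ i, M i (x i) (y i)

theorem piMat_mul {m : Type} [Fintype m] {k : ℕ} (M N : Fin k → Matrix m m ℂ) :
    piMat M * piMat N = piMat fun i => M i * N i := by
  ext x y
  simp only [piMat, Matrix.mul_apply, Matrix.of_apply, ← Finset.prod_mul_distrib]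
  exact (Fintype.prod_sum fun i j => M i (x i) j * N i j (y i)).symm

theorem piMat_conjTranspose {m : Type} {k : ℕ} (M : Fin k → Matrix m m ℂ) :
    (piMat M).conjTranspose = piMat fun i => (M i).conjTranspose := by
  ext x y
  simp [piMat]

theorem piMat_one {m : Type} [DecidableEq m] {k : ℕ} :
    piMat (fun _ : Fin k => (1 : Matrix m m ℂ)) = 1 := by
  ext x y
  simp only [piMat, Matrix.of_apply, Matrix.one_apply]
  split_ifs with h
  · simp [h]
  · obtain ⟨j, hj⟩ := Function.ne_iff.mp h
    exact Finset.prod_eq_zero (Finset.mem_univ j) (if_neg hj)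

theorem piMat_mem_unitaryGroup {m : Type} [Fintype m] [DecidableEq m] {k : ℕ}
    {M : Fin k → Matrix m m ℂ} (h : ∀ i, M i ∈ Matrix.unitaryGroup m ℂ) :
    piMat M ∈ Matrix.unitaryGroup (Fin k → m) ℂ := by
  rw [Matrix.mem_unitaryGroup_iff, Matrix.star_eq_conjTranspose, piMat_conjTranspose, piMat_mul]
  have : (fun i => M i * (M i).conjTranspose) = fun _ => 1 :=
    funext fun i => Matrix.mem_unitaryGroup_iff.mp (h i)
  rw [this, piMat_one]

theorem IsOperatorBasis.piMat {m S : Type} [Fintype m] [DecidableEq m] [Fintype S]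
    {P : S → Matrix m m ℂ} (h : IsOperatorBasis P) (k : ℕ) :
    IsOperatorBasis fun s : Fin k → S => piMat fun i => P (s i) where
  complete x r x' r' := by
    have h1 : ∀ s : Fin k → S, _root_.piMat (fun i => P (s i)) x r *
        star (_root_.piMat (fun i => P (s i)) x' r') =
        ∏ i, P (s i) (x i) (r i) * star (P (s i) (x' i) (r' i)) := fun s => by
      simp [_root_.piMat, Finset.prod_mul_distrib]
    simp only [h1]
    rw [← Fintype.prod_sum fun i j => P j (x i) (r i) * star (P j (x' i) (r' i))]
    simp only [h.complete]
    split_ifs with h2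
    · obtain ⟨rfl, rfl⟩ := h2
      simp
    · have : ∃ j, ¬ (x j = x' j ∧ r j = r' j) := by
        by_contra hcon
        push Not at hcon
        exact h2 ⟨funext fun j => (hcon j).1, funext fun j => (hcon j).2⟩
      obtain ⟨j, hj⟩ := this
      exact Finset.prod_eq_zero (Finset.mem_univ j) (if_neg hj)
  card_eq := by
    simp only [Fintype.card_fun, h.card_eq, Fintype.card_fin]
    ring

theorem tensorPow_eq_submatrix {m n : Type} (k : ℕ) (M : Matrix (m × n) (m × n) ℂ) :
    tensorPow k M = (piMat fun _ => M).submatrix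
      (Equiv.arrowProdEquivProdArrow (Fin k) (fun _ => m) (fun _ => n)).symm
      (Equiv.arrowProdEquivProdArrow (Fin k) (fun _ => m) (fun _ => n)).symm := rfl

theorem piMat_kronecker_piMat {m n : Type} {k : ℕ} (M : Fin k → Matrix m m ℂ)
    (N : Fin k → Matrix n n ℂ) :
    piMat M ⊗ₖ piMat N = (piMat fun i => M i ⊗ₖ N i).submatrix
      (Equiv.arrowProdEquivProdArrow (Fin k) (fun _ => m) (fun _ => n)).symm
      (Equiv.arrowProdEquivProdArrow (Fin k) (fun _ => m) (fun _ => n)).symm := by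
  ext x y
  simp [piMat, Finset.prod_mul_distrib]

/-- Powers are the reason for abstracting from Clifford gates: the property passes to factorwise
tensor products, with no need to regard `U^{⊗k}` as a Clifford gate on a relabelled register. -/
theorem IsTeleportable.tensorPow {m n : Type} [Fintype m] [Fintype n] [DecidableEq m]
    [DecidableEq n] {U : Matrix (m × n) (m × n) ℂ} (h : IsTeleportable U) (k : ℕ) :
    IsTeleportable (tensorPow k U) := by
  obtain ⟨hU, S, S', _, _, P, P', hP, hP', hQR⟩ := h
  choose Q hQ R hR hQR using hQR
  refine ⟨?_, Fin k → S, Fin k → S', inferInstance, inferInstance, _, _, hP.piMat k, hP'.piMat k,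
    fun s t => ⟨piMat fun i => Q (s i) (t i), piMat_mem_unitaryGroup fun i => hQ _ _,
      piMat fun i => R (s i) (t i), piMat_mem_unitaryGroup fun i => hR _ _, ?_⟩⟩
  · have h1 := Matrix.mem_unitaryGroup_iff.mp (piMat_mem_unitaryGroup (k := k) fun _ => hU)
    rw [Matrix.mem_unitaryGroup_iff, Matrix.star_eq_conjTranspose, tensorPow_eq_submatrix,
      Matrix.conjTranspose_submatrix, Matrix.submatrix_mul_equiv, ← Matrix.star_eq_conjTranspose, h1,
      Matrix.submatrix_one_equiv]
  · rw [tensorPow_eq_submatrix, Matrix.conjTranspose_submatrix, piMat_kronecker_piMat,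
      Matrix.submatrix_mul_equiv, Matrix.submatrix_mul_equiv, piMat_conjTranspose, piMat_mul,
      piMat_mul, piMat_kronecker_piMat]
    simp only [hQR]

/-! ## Pauli matrices and Clifford unitaries -/

theorem pauliMatrix_mem_unitaryGroup (s : Fin 4) :
    pauliMatrix s ∈ Matrix.unitaryGroup (Fin 2) ℂ := by
  rw [Matrix.mem_unitaryGroup_iff]
  fin_cases s <;> ext i j <;> fin_cases i <;> fin_cases j <;>
    simp [pauliMatrix, Matrix.mul_apply, Matrix.star_apply]

theorem isOperatorBasis_pauliMatrix : IsOperatorBasis pauliMatrix where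
  complete x r x' r' := by
    rw [Fin.sum_univ_four, show pauliMatrix 0 = 1 from rfl,
      show pauliMatrix 1 = !![0, 1; 1, 0] from rfl,
      show pauliMatrix 2 = !![0, -Complex.I; Complex.I, 0] from rfl,
      show pauliMatrix 3 = !![1, 0; 0, -1] from rfl]
    fin_cases x <;> fin_cases r <;> fin_cases x' <;> fin_cases r' <;>
      norm_num [Matrix.one_apply]
  card_eq := by simp

theorem smul_mem_unitaryGroup {m : Type} [Fintype m] [DecidableEq m] {M : Matrix m m ℂ}
    (h : M ∈ Matrix.unitaryGroup m ℂ) {c : ℂ} (hc : c * star c = 1) :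
    c • M ∈ Matrix.unitaryGroup m ℂ := by
  rw [Matrix.mem_unitaryGroup_iff, star_smul, Matrix.smul_mul, Matrix.mul_smul, smul_smul, hc,
    Matrix.mem_unitaryGroup_iff.mp h, one_smul]

theorem IsClifford.isTeleportable {a b : ℕ}
    {U : Matrix (Qubits a × Qubits b) (Qubits a × Qubits b) ℂ} (h : IsClifford U) :
    IsTeleportable U := by
  refine ⟨h.1, Fin a → Fin 4, Fin b → Fin 4, inferInstance, inferInstance, pauliString,
    pauliString, isOperatorBasis_pauliMatrix.piMat a, isOperatorBasis_pauliMatrix.piMat b,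
    fun s t => ?_⟩
  have hmem : pauliString s ⊗ₖ pauliString t ∈ pauliGroup a b := ⟨0, s, t, by simp⟩
  obtain ⟨c, s', t', h1⟩ := h.2 ▸ Set.mem_image_of_mem (fun P => U * P * U.conjTranspose) hmem
  have hI : Complex.I * star Complex.I = 1 := by simp
  -- The phase of the conjugated Pauli operator is absorbed into Alice's factor.
  refine ⟨Complex.I ^ (c : ℕ) • pauliString s', smul_mem_unitaryGroup (piMat_mem_unitaryGroup
      fun i => pauliMatrix_mem_unitaryGroup _) ?_, pauliString t',
    piMat_mem_unitaryGroup fun i => pauliMatrix_mem_unitaryGroup _, ?_⟩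
  · rw [star_pow, ← mul_pow, hI, one_pow]
  · rw [Matrix.smul_kronecker]
    exact h1

/-- The γ-factor of a teleportable unitary. -/
theorem IsSchmidt.gammaLOCC_unitaryChannel_eq {m n ι : Type} [Fintype m] [Fintype n]
    [DecidableEq m] [DecidableEq n] [Nonempty m] [Nonempty n] [Fintype ι] [DecidableEq ι]
    {U : Matrix (m × n) (m × n) ℂ} {α : ι → ℝ} {e : ι → m × m → ℂ} {f : ι → n × n → ℂ}
    (h : IsSchmidt (choi U) α e f) (hU : IsTeleportable U) :
    gammaLOCC (unitaryChannel U) = ENNReal.ofReal (2 * (∑ s, α s) ^ 2 - 1) ∧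
      gammaLOCC (unitaryChannel U) ∈ qpdCosts (unitaryChannel U) := by
  obtain ⟨T, hT, hTU⟩ := hU.exists_gadget
  have hmem := h.mem_qpdCosts (sum_star_choi hU.1) hT hTU
  have heq : gammaLOCC (unitaryChannel U) = ENNReal.ofReal (2 * (∑ s, α s) ^ 2 - 1) :=
    le_antisymm (sInf_le hmem) (h.le_gammaLOCC_unitaryChannel hU.1)
  exact ⟨heq, heq ▸ hmem⟩

/-! ## The CNOT gate -/

/-- CNOT permutes the basis by `(x, y) ↦ (x, y + x)`, an involution because addition is modulo 2, so
conjugation only relabels entries. -/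
theorem cnot_mul_mul_conjTranspose_apply
    (M : Matrix (Qubits 1 × Qubits 1) (Qubits 1 × Qubits 1) ℂ) (x y x' y' : Qubits 1) :
    (cnot * M * cnot.conjTranspose) (x, y) (x', y') = M (x, y + x) (x', y' + x') := by
  have h : ∀ x y z w : Qubits 1, (x = z ∧ y = w + z) ↔ z = x ∧ w = y + x := by decide
  simp [cnot, Matrix.mul_apply, Fintype.sum_prod_type, h, ite_and, Finset.sum_ite_irrel,
    apply_ite (starRingEnd ℂ)]

theorem cnot_conjTranspose : cnot.conjTranspose = cnot := by
  ext x y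
  have h : (y.1 = x.1 ∧ y.2 = x.2 + x.1) ↔ (x.1 = y.1 ∧ x.2 = y.2 + y.1) := by
    revert x y
    decide
  simp [cnot, h]

theorem cnot_mul_cnot : cnot * cnot = 1 := by
  have h := cnot_mul_mul_conjTranspose_apply 1
  rw [Matrix.mul_one, cnot_conjTranspose] at h
  ext ⟨x, y⟩ ⟨x', y'⟩
  rw [h]
  have h1 : ((x, y + x) = (x', y' + x')) ↔ (x, y) = (x', y') := by
    revert x y x' y'
    decide
  simp only [Matrix.one_apply, h1]

theorem cnot_mem_unitaryGroup : cnot ∈ Matrix.unitaryGroup (Qubits 1 × Qubits 1) ℂ := by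
  rw [Matrix.mem_unitaryGroup_iff, Matrix.star_eq_conjTranspose, cnot_conjTranspose, cnot_mul_cnot]

theorem qubits_one_add_self : (1 : Qubits 1) + 1 = 0 := by decide

theorem isEntangling_cnot : IsEntangling cnot := by
  rintro ⟨V, -, W, -, h⟩
  have key : ∀ x y x' y', V x x' * W y y' = cnot (x, y) (x', y') := by
    intro x y x' y'
    rw [h]
    rfl
  have h1 : V 0 0 * W 0 0 = 1 := (key 0 0 0 0).trans (by simp [cnot])
  have h2 : V 1 1 * W 0 1 = 1 := (key 1 0 1 1).trans (by
    simp [cnot, qubits_one_add_self])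
  have h3 : V 0 0 * W 0 1 = 0 := (key 0 0 0 1).trans (by
    simp [cnot, show (0 : Qubits 1) ≠ 1 by decide])
  rcases mul_eq_zero.mp h3 with h3 | h3
  · simp [h3] at h1
  · simp [h3] at h2

/-- The phase and the indices of the Pauli operators in `CNOT (σ_s ⊗ σ_t) CNOT†`. -/
def cnotPauli : Fin 4 → Fin 4 → Fin 4 × Fin 4 × Fin 4 :=
  ![![(0, 0, 0), (0, 0, 1), (0, 3, 2), (0, 3, 3)],
    ![(0, 1, 1), (0, 1, 0), (0, 2, 3), (2, 2, 2)],
    ![(0, 2, 1), (0, 2, 0), (2, 1, 3), (0, 1, 2)],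
    ![(0, 3, 0), (0, 3, 1), (0, 0, 2), (0, 0, 3)]]

/-- A finite check on entries. The only nontrivial phases are the signs in `X ⊗ Z ↦ -Y ⊗ Y` and `Y ⊗
Y ↦ -X ⊗ Z`. -/
theorem pauliMatrix_cnot (s t : Fin 4) (x y x' y' : Fin 2) :
    pauliMatrix s x x' * pauliMatrix t (y + x) (y' + x') =
      Complex.I ^ ((cnotPauli s t).1 : ℕ) *
        (pauliMatrix (cnotPauli s t).2.1 x x' * pauliMatrix (cnotPauli s t).2.2 y y') := by
  fin_cases s <;> fin_cases t <;> fin_cases x <;> fin_cases y <;> fin_cases x' <;> fin_cases y' <;>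
    simp [pauliMatrix, cnotPauli]

theorem pauliString_apply (s : Fin 1 → Fin 4) (x x' : Qubits 1) :
    pauliString s x x' = pauliMatrix (s 0) (x 0) (x' 0) := by
  simp [pauliString]

theorem cnot_conj_mem_pauliGroup {P : Matrix (Qubits 1 × Qubits 1) (Qubits 1 × Qubits 1) ℂ}
    (hP : P ∈ pauliGroup 1 1) : cnot * P * cnot.conjTranspose ∈ pauliGroup 1 1 := by
  obtain ⟨c, s, t, rfl⟩ := hP
  refine ⟨c + (cnotPauli (s 0) (t 0)).1, fun _ => (cnotPauli (s 0) (t 0)).2.1,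
    fun _ => (cnotPauli (s 0) (t 0)).2.2, ?_⟩
  have hI : ∀ c d : Fin 4, Complex.I ^ ((c + d : Fin 4) : ℕ) =
      Complex.I ^ (c : ℕ) * Complex.I ^ (d : ℕ) := by
    intro c d
    rw [← pow_add, Fin.val_add]
    exact (Complex.I_pow_eq_pow_mod _).symm
  ext ⟨x, y⟩ ⟨x', y'⟩
  rw [cnot_mul_mul_conjTranspose_apply]
  simp only [Matrix.smul_apply, Matrix.kroneckerMap_apply, pauliString_apply, Pi.add_apply,
    smul_eq_mul, pauliMatrix_cnot, hI]
  ring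

theorem isClifford_cnot : IsClifford cnot := by
  refine ⟨cnot_mem_unitaryGroup, Set.Subset.antisymm ?_ fun P hP => ?_⟩
  · rintro _ ⟨P, hP, rfl⟩
    exact cnot_conj_mem_pauliGroup hP
  -- CNOT is its own inverse, so the conjugate of `P` is a preimage of `P`.
  · refine ⟨_, cnot_conj_mem_pauliGroup hP, ?_⟩
    simp only [cnot_conjTranspose, Matrix.mul_assoc, cnot_mul_cnot, Matrix.mul_one]
    rw [← Matrix.mul_assoc, cnot_mul_cnot, Matrix.one_mul]

/-! ### Nonlocal CNOT from one Bell pair. -/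

theorem sum_qubits_one (f : Qubits 1 → ℂ) : ∑ x, f x = f 0 + f 1 :=
  (Equiv.sum_comp (Equiv.funUnique (Fin 1) (Fin 2)).symm f).symm.trans (Fin.sum_univ_two _)

theorem qubits_one_cases (x : Qubits 1) : x = 0 ∨ x = 1 := by
  revert x
  decide

theorem card_qubits_one : Fintype.card (Qubits 1) = 2 := by simp

/-- The sign `(-1)^{ve}`. -/
def bitSign (v e : Qubits 1) : ℂ := if v = 1 ∧ e = 1 then -1 else 1

/-- Alice's Kraus operators for the nonlocal CNOT gate: she measures the parity `u` of the control
and her half of the Bell pair. -/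
def cnotKrausLeft (u : Qubits 1) : Matrix (Qubits 1) (Qubits 1 × Qubits 1) ℂ :=
  Matrix.of fun x z => if x = z.1 ∧ z.2 + z.1 = u then 1 else 0

/-- Bob's Kraus operators for the nonlocal CNOT gate: he adds his half of the Bell pair, corrected
by `u`, to the target, and measures it in the Hadamard basis. -/
noncomputable def cnotKrausRight (u v : Qubits 1) : Matrix (Qubits 1) (Qubits 1 × Qubits 1) ℂ :=
  Matrix.of fun y z => if y = z.1 + z.2 + u then ((√2 : ℝ) : ℂ)⁻¹ * bitSign v z.2 else 0

theorem inv_sqrt_two_mul_self : ((√2 : ℝ) : ℂ)⁻¹ * ((√2 : ℝ) : ℂ)⁻¹ = 2⁻¹ := by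
  simpa using inv_sqrt_natCast_mul_self 2

theorem star_bitSign (v e : Qubits 1) : star (bitSign v e) = bitSign v e := by
  rw [bitSign]
  split_ifs <;> simp

theorem bitSign_mul_self (v e : Qubits 1) : bitSign v e * bitSign v e = 1 := by
  rw [bitSign]
  split_ifs <;> simp

theorem sum_cnotKrausLeft : ∑ u, (cnotKrausLeft u).conjTranspose * cnotKrausLeft u = 1 := by
  ext ⟨x, e⟩ ⟨x', e'⟩
  have h : ∀ x e x' e' : Qubits 1, ((x = x' ∧ e' + x' = e + x) ↔ ((x, e) = (x', e'))) := by decide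
  have h1 : ∀ u, ((cnotKrausLeft u).conjTranspose * cnotKrausLeft u) (x, e) (x', e') =
      if e + x = u then if x = x' ∧ e' + x' = u then 1 else 0 else 0 := by
    intro u
    simp [cnotKrausLeft, Matrix.mul_apply, apply_ite (starRingEnd ℂ), ite_and]
    grind
  simp only [Matrix.sum_apply, h1, Matrix.one_apply, ← h]
  simp

theorem sum_bitSign (e e' : Qubits 1) :
    ∑ v, bitSign v e * bitSign v e' = if e = e' then 2 else 0 := by
  have h01 : (0 : Qubits 1) ≠ 1 := by decide
  rw [sum_qubits_one]
  rcases qubits_one_cases e with rfl | rfl <;> rcases qubits_one_cases e' with rfl | rfl <;>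
    norm_num [bitSign, h01, h01.symm]

theorem sum_cnotKrausRight (u : Qubits 1) :
    ∑ v, (cnotKrausRight u v).conjTranspose * cnotKrausRight u v = 1 := by
  ext ⟨y, e⟩ ⟨y', e'⟩
  have h1 : ∀ v, ((cnotKrausRight u v).conjTranspose * cnotKrausRight u v) (y, e) (y', e') =
      (if y + e + u = y' + e' + u then 2⁻¹ else 0) * (bitSign v e * bitSign v e') := by
    intro v
    rw [← inv_sqrt_two_mul_self]
    simp only [cnotKrausRight, Matrix.mul_apply, Matrix.conjTranspose_apply, Matrix.of_apply]
    rw [Finset.sum_eq_single (y + e + u)]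
    · rw [if_pos rfl, star_mul', star_bitSign]
      split_ifs
      · simp
        ring
      · simp
    · intro b _ hb
      simp [hb]
    · simp
  simp only [Matrix.sum_apply, h1, ← Finset.mul_sum, sum_bitSign, Matrix.one_apply,
    add_left_inj, Prod.mk.injEq]
  by_cases he : e = e'
  · subst he
    by_cases hy : y = y' <;> simp [hy]
  · simp [he]

theorem diagonal_bitSign_mem_unitaryGroup (u v : Qubits 1) :
    Matrix.diagonal (fun x => bitSign v (x + u)) ∈ Matrix.unitaryGroup (Qubits 1) ℂ := by
  rw [Matrix.mem_unitaryGroup_iff, Matrix.star_eq_conjTranspose, Matrix.diagonal_conjTranspose,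
    Matrix.diagonal_mul_diagonal, ← Matrix.diagonal_one]
  congr 1
  ext x
  rw [Pi.star_apply, star_bitSign, bitSign_mul_self]

/-- Alice's parity outcome `u` forces the Bell bit to be `e = x + u`, so Bob's addition of `e + u`
adds the control `x` to the target. His Hadamard measurement erases `e` and leaves the sign
`(-1)^{v(x+u)}`, which Alice removes by a diagonal unitary. Bob's correction is already part of his
Kraus operators, hence `R = 1`. The factor `c = 1/2` combines `1/√2` from the Bell pair and `1/√2`
from the measurement. -/
theorem exists_cnot_gadget : ∃ T : Superop ((Qubits 1 × Qubits 1) × (Qubits 1 × Qubits 1))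
    (Qubits 1 × Qubits 1), IsLOCC T ∧ ∀ ρ, T (attach (Qubits 1) (Qubits 1)
      (proj (maxEnt (Qubits 1))) ρ) = unitaryChannel cnot ρ := by
  refine ⟨_, isLOCC_measure_correct sum_cnotKrausLeft sum_cnotKrausRight
    diagonal_bitSign_mem_unitaryGroup (R := fun _ _ => 1) (fun _ _ => one_mem _),
    sum_kraus_attach (c := 2⁻¹) (fun u v => ?_) ?_⟩
  · ext ⟨x, y⟩ ⟨x', y'⟩
    rw [kronecker_mul_attachVec_apply, ← inv_sqrt_two_mul_self]
    have h1 : ∀ e : Qubits 1, (Matrix.diagonal (fun x => bitSign v (x + u)) * cnotKrausLeft u) x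
        (x', e) = if e = x' + u then if x = x' then bitSign v (x + u) else 0 else 0 := by
      intro e
      have h2 : e + x' = u ↔ e = x' + u := by
        revert e x' u
        decide
      simp only [Matrix.diagonal_mul, cnotKrausLeft, Matrix.of_apply, h2]
      split_ifs <;> simp_all
    have h3 : ∀ u x' y' : Qubits 1, y' + (x' + u) + u = y' + x' := by decide
    rw [Finset.sum_eq_single (x' + u) (fun e _ he => by simp [h1, he]) (by simp)]
    simp only [h1, Matrix.one_mul, cnotKrausRight, Matrix.of_apply, maxEnt, mul_ite, mul_zero,
      Finset.sum_ite_eq, Finset.mem_univ, if_true, ite_mul, zero_mul,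
      Matrix.smul_apply, smul_eq_mul, cnot, card_qubits_one, h3]
    by_cases hx : x = x'
    · subst hx
      by_cases hy : y = y' + x
      · simp [hy]
        linear_combination ((√2 : ℝ) : ℂ)⁻¹ * bitSign_mul_self v (x + u)
      · simp [hy]
    · simp [hx]
  · rw [card_qubits_one]
    norm_num

/-! ### Schmidt data of the Bell pair and of the CNOT Choi state. -/

theorem isSchmidt_maxEnt (m : Type) [Fintype m] [DecidableEq m] :
    IsSchmidt (maxEnt m) (fun _ : m => (√(Fintype.card m))⁻¹) (fun s => Pi.single s 1)
      (fun s => Pi.single s 1) where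
  nonneg _ := by positivity
  orth_left s t := by simp [Pi.single_apply, eq_comm]
  orth_right s t := by simp [Pi.single_apply, eq_comm]
  eq i j := by
    simp [maxEnt, Pi.single_apply]

/-- This is `CNOT = |0⟩⟨0| ⊗ 1 + |1⟩⟨1| ⊗ X`: the index is the control value, and `1` and `X` are
orthogonal as operators. -/
theorem isSchmidt_choi_cnot : IsSchmidt (choi cnot) (fun _ : Qubits 1 => (√2)⁻¹)
    (fun s => Pi.single (s, s) 1) (fun s y => if y.1 = y.2 + s then ((√2 : ℝ) : ℂ)⁻¹ else 0) where
  nonneg _ := by positivity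
  orth_left s t := by simp [Pi.single_apply, eq_comm]
  orth_right s t := by
    have h : ∀ y s t : Qubits 1, (y = y + s + t) ↔ s = t := by decide
    simp only [Fintype.sum_prod_type_right, apply_ite star, star_zero, ite_mul, zero_mul, mul_ite,
      mul_zero, Finset.sum_ite_eq', Finset.mem_univ, if_true, add_right_inj]
    by_cases hst : s = t
    · subst hst
      simp [inv_sqrt_two_mul_self]
    · simp [hst, Ne.symm hst]
  eq i j := by
    rw [choi_apply, card_qubits_one, Finset.sum_eq_single i.1]
    · obtain ⟨x, x'⟩ := i
      by_cases hx : x = x'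
      · subst hx
        by_cases hy : j.1 = j.2 + x <;> simp [cnot, hy]
      · simp [cnot, hx, Ne.symm hx]
    · intro s _ hs
      simp [Prod.ext_iff, Ne.symm hs]
    · simp

/-! ## γ-factors of Clifford unitaries -/

/-- The induction step rests on `(2x^k - 1)(2x - 1) - (2x^{k+1} - 1) = 2 (x - 1)(x^k - 1)`, which is
nonnegative. -/
theorem two_mul_pow_sub_one_le {x : ℝ} (hx : 1 ≤ x) {k : ℕ} (hk : 1 ≤ k) :
    2 * x ^ k - 1 ≤ (2 * x - 1) ^ k := by
  induction k, hk using Nat.le_induction with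
  | base => simp
  | succ k _ ih =>
    have h1 : 0 ≤ (x - 1) * (x ^ k - 1) :=
      mul_nonneg (sub_nonneg.mpr hx) (sub_nonneg.mpr (one_le_pow₀ hx))
    calc 2 * x ^ (k + 1) - 1 ≤ (2 * x ^ k - 1) * (2 * x - 1) := by
          rw [pow_succ]
          linarith
      _ ≤ _ := by
          rw [pow_succ]
          exact mul_le_mul_of_nonneg_right ih (by linarith)

theorem two_mul_pow_sub_one_lt {x : ℝ} (hx : 1 < x) {k : ℕ} (hk : 1 < k) :
    2 * x ^ k - 1 < (2 * x - 1) ^ k := by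
  obtain ⟨j, rfl⟩ : ∃ j, k = j + 1 := ⟨k - 1, by omega⟩
  have hj : 1 ≤ j := by omega
  have h1 : 0 < (x - 1) * (x ^ j - 1) :=
    mul_pos (sub_pos.mpr hx) (sub_pos.mpr (one_lt_pow₀ hx (by omega)))
  calc 2 * x ^ (j + 1) - 1 < (2 * x ^ j - 1) * (2 * x - 1) := by
        rw [pow_succ]
        linarith
    _ ≤ _ := by
        rw [pow_succ]
        exact mul_le_mul_of_nonneg_right (two_mul_pow_sub_one_le hx.le hj) (by linarith)

theorem two_mul_pow_sub_one_nonneg {A : ℝ} (hA : 1 ≤ A) (k : ℕ) : 0 ≤ 2 * A ^ k - 1 := by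
  linarith [one_le_pow₀ hA (n := k)]

theorem overhead_isBigO {x : ℝ} (hx : 1 ≤ x) {E : ℕ → ℝ≥0∞}
    (hE : ∀ k : ℕ, 1 ≤ k → E k = ENNReal.ofReal ((2 * x ^ k - 1) ^ ((1 : ℝ) / k))) :
    (fun n : ℕ => (E n).toReal ^ (2 * n)) =O[Filter.atTop] fun n : ℕ => (x ^ n) ^ 2 := by
  -- The overhead is `(2x^n - 1)²`, at most `4 (x^n)²`. The case `n = 0`, where `1 / n` is a default
  -- value, is excluded by passing to large `n`.
  refine Asymptotics.IsBigO.of_bound 4 ?_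
  filter_upwards [Filter.eventually_ge_atTop 1] with n hn
  have h0 := two_mul_pow_sub_one_nonneg hx n
  have h1 : ((2 * x ^ n - 1) ^ ((1 : ℝ) / n)) ^ n = 2 * x ^ n - 1 := by
    rw [one_div]
    exact Real.rpow_inv_natCast_pow h0 (by omega)
  rw [hE n hn, ENNReal.toReal_ofReal (Real.rpow_nonneg h0 _), mul_comm 2 n, pow_mul, h1,
    Real.norm_eq_abs, Real.norm_eq_abs, abs_of_nonneg (sq_nonneg _), abs_of_nonneg (sq_nonneg _)]
  have h2 := one_le_pow₀ hx (n := n)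
  nlinarith

section Clifford

variable {m n ι : Type} [Fintype m] [Fintype n] [DecidableEq m] [DecidableEq n] [Nonempty m]
  [Nonempty n] [Fintype ι] [DecidableEq ι] {U : Matrix (m × n) (m × n) ℂ} {α : ι → ℝ}
  {e : ι → m × m → ℂ} {f : ι → n × n → ℂ}

theorem IsSchmidt.gammaLOCC_tensorPow_eq (h : IsSchmidt (choi U) α e f) (hU : IsTeleportable U)
    (k : ℕ) : gammaLOCC (unitaryChannel (tensorPow k U)) =
        ENNReal.ofReal (2 * (∑ s, α s) ^ (2 * k) - 1) ∧
      gammaLOCC (unitaryChannel (tensorPow k U)) ∈ qpdCosts (unitaryChannel (tensorPow k U)) := by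
  obtain ⟨e', f', h'⟩ := h.choi_tensorPow k
  have := h'.gammaLOCC_unitaryChannel_eq (hU.tensorPow k)
  rwa [sum_prod_pow, ← pow_mul, mul_comm k] at this

theorem IsSchmidt.effGammaLOCC_eq (h : IsSchmidt (choi U) α e f) (hU : IsTeleportable U)
    (k : ℕ) : effGammaLOCC k U =
      ENNReal.ofReal ((2 * (∑ s, α s) ^ (2 * k) - 1) ^ ((1 : ℝ) / k)) := by
  rw [effGammaLOCC, (h.gammaLOCC_tensorPow_eq hU k).1]
  exact ENNReal.ofReal_rpow_of_nonneg
    (two_mul_pow_sub_one_nonneg (h.one_le_sum (sum_star_choi hU.1)) _) (by positivity)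

theorem IsSchmidt.gammaLOCCState_tensorPow_eq [Zero m] [Zero n] (h : IsSchmidt (choi U) α e f)
    (hU : U ∈ Matrix.unitaryGroup (m × n) ℂ) (k : ℕ) :
    gammaLOCCState (tensorPow k (proj (choi U))) =
        ENNReal.ofReal (2 * (∑ s, α s) ^ (2 * k) - 1) ∧
      gammaLOCCState (tensorPow k (proj (choi U))) ∈
        statePrepCosts (tensorPow k (proj (choi U))) := by
  have := (h.vecPow k).gammaLOCCState_eq (sum_star_vecPow k (sum_star_choi hU))
  rwa [sum_prod_pow, ← pow_mul, mul_comm k, ← tensorPow_proj] at this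

theorem IsSchmidt.effGammaLOCC_lt (h : IsSchmidt (choi U) α e f) (hU : IsTeleportable U)
    (hE : IsEntangling U) {k : ℕ} (hk : 1 < k) :
    effGammaLOCC k U < gammaLOCC (unitaryChannel U) := by
  have hx := h.one_lt_sum_sq_of_isEntangling hU.1 hE
  have h0 := two_mul_pow_sub_one_nonneg (h.one_le_sum (sum_star_choi hU.1)) (2 * k)
  rw [h.effGammaLOCC_eq hU, (h.gammaLOCC_unitaryChannel_eq hU).1,
    ENNReal.ofReal_lt_ofReal_iff (by linarith)]
  -- Strict monotonicity of the `k`-th root reduces the comparison to `two_mul_pow_sub_one_lt` at `x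
  -- = (∑ α)²`.
  calc _ < ((2 * (∑ s, α s) ^ 2 - 1) ^ k) ^ ((1 : ℝ) / k) := by
        refine Real.rpow_lt_rpow h0 ?_ (by positivity)
        rw [pow_mul]
        exact two_mul_pow_sub_one_lt hx hk
    _ = _ := by
        rw [one_div]
        exact Real.pow_rpow_inv_natCast (by linarith) (by omega)

theorem IsSchmidt.overhead_isBigO (h : IsSchmidt (choi U) α e f) (hU : IsTeleportable U) :
    (fun n : ℕ => (effGammaLOCC n U).toReal ^ (2 * n)) =O[Filter.atTop]
      fun n : ℕ => (((∑ s, α s) ^ 2) ^ n) ^ 2 := by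
  refine _root_.overhead_isBigO (h.one_le_sum_sq (sum_star_choi hU.1)) fun k _ => ?_
  rw [h.effGammaLOCC_eq hU, pow_mul]

end Clifford

theorem sum_inv_sqrt_two_sq : (∑ _s : Qubits 1, (√2 : ℝ)⁻¹) ^ 2 = 2 := by
  rw [Finset.sum_const, Finset.card_univ, card_qubits_one, nsmul_eq_mul, mul_pow, inv_pow,
    Real.sq_sqrt zero_le_two]
  norm_num

theorem teleportationAchieves_cnot :
    TeleportationAchieves cnot (proj (maxEnt (Qubits 1))) (fun k => 2 ^ (k + 1) - 1) := by
  obtain ⟨T, hT, hTU⟩ := exists_cnot_gadget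
  have h := (isSchmidt_maxEnt (Qubits 1)).teleportationAchieves (sum_star_maxEnt _) hT hTU
  convert h using 2 with k
  have := sum_inv_sqrt_two_sq
  rw [pow_mul, card_qubits_one, Nat.cast_ofNat, this]
  ring

theorem theorem3 :
    (∀ (a b : ℕ) (U : Matrix (Qubits a × Qubits b) (Qubits a × Qubits b) ℂ), IsClifford U →
      ∀ (r : ℕ) (α : Fin r → ℝ), HasSchmidtCoefficients (choi U) α →
        -- a single instance of the gate
        (gammaLOCC (unitaryChannel U) = gammaLOCCState (proj (choi U)) ∧
          gammaLOCCState (proj (choi U)) = ENNReal.ofReal (2 * (∑ s, α s) ^ 2 - 1)) ∧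
        -- `k` instances of the gate
        (∀ k : ℕ, 1 ≤ k →
          effGammaLOCC k U = gammaLOCCState (tensorPow k (proj (choi U))) ^ ((1 : ℝ) / k) ∧
          gammaLOCCState (tensorPow k (proj (choi U))) ^ ((1 : ℝ) / k) =
            ENNReal.ofReal ((2 * (∑ s, α s) ^ (2 * k) - 1) ^ ((1 : ℝ) / k))) ∧
        -- the minima that define these γ-factors are attained
        (gammaLOCC (unitaryChannel U) ∈ qpdCosts (unitaryChannel U) ∧
          gammaLOCCState (proj (choi U)) ∈ statePrepCosts (proj (choi U)) ∧
          ∀ k : ℕ, 1 ≤ k →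
            gammaLOCC (unitaryChannel (tensorPow k U)) ∈ qpdCosts (unitaryChannel (tensorPow k U)) ∧
            gammaLOCCState (tensorPow k (proj (choi U))) ∈
              statePrepCosts (tensorPow k (proj (choi U)))) ∧
        -- gate teleportation with a memory of `k` Choi states achieves the effective factor
        TeleportationAchieves U (proj (choi U)) (fun k => 2 * (∑ s, α s) ^ (2 * k) - 1) ∧
        -- strict advantage for entangling gates
        (IsEntangling U → 1 < (∑ s, α s) ^ 2 ∧
          ∀ k : ℕ, 1 < k → effGammaLOCC k U < gammaLOCC (unitaryChannel U)) ∧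
        -- total overhead of many instances
        (fun n : ℕ => (effGammaLOCC n U).toReal ^ (2 * n)) =O[Filter.atTop]
          (fun n : ℕ => (∑ s, α s) ^ (4 * n))) ∧
    -- the CNOT gate
    (IsClifford cnot ∧ IsEntangling cnot ∧
      gammaLOCC (unitaryChannel cnot) = 3 ∧
      (∀ k : ℕ, 1 ≤ k →
        effGammaLOCC k cnot = ENNReal.ofReal (((2 : ℝ) ^ (k + 1) - 1) ^ ((1 : ℝ) / k))) ∧
      TeleportationAchieves cnot (proj (maxEnt (Qubits 1))) (fun k => 2 ^ (k + 1) - 1) ∧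
      (∀ n : ℕ, (gammaLOCC (unitaryChannel cnot)).toReal ^ (2 * n) = 9 ^ n) ∧
      (fun n : ℕ => (effGammaLOCC n cnot).toReal ^ (2 * n)) =O[Filter.atTop]
        (fun n : ℕ => (4 : ℝ) ^ n)) := by
  refine ⟨fun a b U hU r α hα => ?_, isClifford_cnot, isEntangling_cnot, ?_, fun k _ => ?_,
    teleportationAchieves_cnot, fun n => ?_, ?_⟩
  · obtain ⟨e, f, h⟩ := hα.exists_isSchmidt
    have hT := hU.isTeleportable
    have hψ := sum_star_choi hU.1
    obtain ⟨hU1, hU2⟩ := h.gammaLOCC_unitaryChannel_eq hT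
    obtain ⟨hS1, hS2⟩ := h.gammaLOCCState_eq hψ
    obtain ⟨T, hTL, hTU⟩ := hT.exists_gadget
    refine ⟨⟨hU1.trans hS1.symm, hS1⟩, fun k _ => ?_, ⟨hU2, hS2, fun k _ =>
      ⟨(h.gammaLOCC_tensorPow_eq hT k).2, (h.gammaLOCCState_tensorPow_eq hU.1 k).2⟩⟩,
      h.teleportationAchieves hψ hTL hTU, fun hE =>
      ⟨h.one_lt_sum_sq_of_isEntangling hU.1 hE, fun k hk => h.effGammaLOCC_lt hT hE hk⟩, ?_⟩
    · have h1 : gammaLOCC (unitaryChannel (tensorPow k U)) =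
          gammaLOCCState (tensorPow k (proj (choi U))) :=
        (h.gammaLOCC_tensorPow_eq hT k).1.trans (h.gammaLOCCState_tensorPow_eq hU.1 k).1.symm
      rw [← h1]
      exact ⟨rfl, h.effGammaLOCC_eq hT k⟩
    · refine (h.overhead_isBigO hT).congr_right fun n => ?_
      rw [← pow_mul, ← pow_mul]
      congr 1
      ring
  · rw [(isSchmidt_choi_cnot.gammaLOCC_unitaryChannel_eq isClifford_cnot.isTeleportable).1,
      sum_inv_sqrt_two_sq]
    norm_num
  · rw [isSchmidt_choi_cnot.effGammaLOCC_eq isClifford_cnot.isTeleportable, pow_mul,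
      sum_inv_sqrt_two_sq]
    congr 3
    ring
  · rw [(isSchmidt_choi_cnot.gammaLOCC_unitaryChannel_eq isClifford_cnot.isTeleportable).1,
      sum_inv_sqrt_two_sq, ENNReal.toReal_ofReal (by norm_num), pow_mul]
    norm_num
  · refine (isSchmidt_choi_cnot.overhead_isBigO isClifford_cnot.isTeleportable).congr_right
      fun n => ?_
    -- With `(∑ α)² = 2`, the bound `(2^n)²` is `4^n`.
    rw [sum_inv_sqrt_two_sq, ← pow_mul, mul_comm, pow_mul]
    norm_num
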